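/- **Setting.** Let $\Sigma$ be the hexagonal lattice drawn as a brick wall: vertices $\mathbb{Z}^2$, horizontal unit edges, vertical unit edges going up from the $(i,j)$ with $i+j$ even; its faces are the bricks $[i,i+2]\times[j,j+1]$ with $i+j$ even, each with six boundary vertices $\partial f$, coloured green, red, blue according to $i \bmod 3 = 0,1,2$ (adjacent faces have different colours). A qubit sits on each vertex. For $\Lambda\subset\mathbb{Z}^2$ let $\mathcal A(\Lambda)$ be the $C^*$-algebra $\overline{\bigcup_{\Lambda'\subset\Lambda\text{ finite}}\bigotimes_{v\in\Lambda'}M_2(\mathbb{C})}$, and $\mathcal A=\mathcal A(\mathbb{Z}^2)$. Put $K_f=\bigotimes_{v\in\partial f}\sigma^{\mathtt x}_v$, $J_f=\bigotimes_{v\in\partial f}\sigma^{\mathtt z}_v$, and let $\omega_0$ be the ground state of the color code, i.e. the unique state on $\mathcal A$ with $\omega_0(K_f)=\omega_0(J_f)=1$ for all faces $f$; let $\pi_0$ be a GNS representation of $\omega_0$. A cone is a set of vertices $\{x\in\mathbb{Z}^2: (x-p)\cdot a>\|x-p\|\cos\theta\}$ with $p,a\in\mathbb{R}^2$, $\|a\|=1$,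 $\theta\in(0,\pi)$. A representation $\pi$ of $\mathcal A$ is a superselection sector if $\pi|_{\mathcal A(\Lambda^c)}\simeq\pi_0|_{\mathcal A(\Lambda^c)}$ (unitary equivalence) for every cone $\Lambda$. For a colour $c\in\{\mathtt r,\mathtt g,\mathtt b\}$, a half-infinite string of colour $c$ is a sequence $\gamma=(f_0,v_0,v_1,f_1,v_2,v_3,f_2,\dots)$ of faces $f_n$ of colour $c$ and pairwise distinct vertices $v_m$ such that $v_{2n}\in\partial f_n$ and $v_{2n+1}\in\partial f_{n+1}$ are joined by an edge and $f_n\ne f_{n+1}$. With $\gamma_n=\{v_0,\dots,v_{2n-1}\}$ put $S^{c\mathtt x}_{\gamma_n}=\bigotimes_{v\in\gamma_n}\sigma^{\mathtt x}_v$, $S^{c\mathtt z}_{\gamma_n}=\bigotimes_{v\in\gamma_n}\sigma^{\mathtt z}_v$, $S^{c\mathtt y}_{\gamma_n}=S^{c\mathtt x}_{\gamma_n}S^{c\mathtt z}_{\gamma_n}$, and for $k\in\{\mathtt x,\mathtt y,\mathtt z\}$ define the endomorphism $\rho^{ck}_\gamma(A)=\lim_n (S^{ck}_{\gamma_n})^\dagger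 A\,S^{ck}_{\gamma_n}$ of $\mathcal A$. Let $\pi^{ck}$ be a GNS representation of $\omega_0\circ\rho^{ck}_\gamma$ for some half-infinite string $\gamma$ of colour $c$ contained in a cone. Let $\gamma_{\mathtt g},\gamma_{\mathtt r},\gamma_{\mathtt b}$ be the vertical half-infinite strings going up from the mutually adjacent faces with lower left corners $(0,0)$, $(1,-1)$, $(2,0)$; let $\pi^{ck,c'k'}$ be a GNS representation of $\omega_0\circ\rho^{ck}_{\gamma_c}\circ\rho^{c'k'}_{\gamma_{c'}}$ and put $$\pi^{\mathtt f_1}=\pi^{\mathtt{rx},\mathtt{bz}},\ \pi^{\mathtt f_2}=\pi^{\mathtt{rz},\mathtt{bx}},\ \pi^{\mathtt f_3}=\pi^{\mathtt{bz},\mathtt{gy}},\ \pi^{\mathtt f_4}=\pi^{\mathtt{rz},\mathtt{gy}},\ \pi^{\mathtt f_5}=\pi^{\mathtt{rx},\mathtt{gy}},\ \pi^{\mathtt f_6}=\pi^{\mathtt{bx},\mathtt{gy}}.$$ The tensor product of endomorphisms is $(\rho\otimes\rho')(A)=\rho(\rho'(A))$. A relation $\pi\simeq\pi^{ck}\otimes\pi^{c'k'}$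 means: for all half-infinite strings $\gamma,\gamma'$ of colours $c,c'$, each contained in some cone, $\pi^{ck}\simeq\pi_0\circ\rho^{ck}_\gamma$, $\pi^{c'k'}\simeq\pi_0\circ\rho^{c'k'}_{\gamma'}$ and $\pi\simeq\pi_0\circ(\rho^{ck}_\gamma\otimes\rho^{c'k'}_{\gamma'})$. **Proposition.** The representations $\pi^{ck}$ ($c\in\{\mathtt r,\mathtt g,\mathtt b\}$, $k\in\{\mathtt x,\mathtt y,\mathtt z\}$) and $\pi^{\mathtt f_j}$ ($1\le j\le 6$) are superselection sectors, and they obey the following fusion relations: $$\begin{aligned} &\pi^{\mathtt f_1}\simeq\pi^{\mathtt{rx}}\otimes\pi^{\mathtt{bz}}\simeq\pi^{\mathtt{ry}}\otimes\pi^{\mathtt{gz}}\simeq\pi^{\mathtt{gx}}\otimes\pi^{\mathtt{by}},\\ &\pi^{\mathtt f_2}\simeq\pi^{\mathtt{rz}}\otimes\pi^{\mathtt{bx}}\simeq\pi^{\mathtt{ry}}\otimes\pi^{\mathtt{gx}}\simeq\pi^{\mathtt{gz}}\otimes\pi^{\mathtt{by}},\\ &\pi^{\mathtt f_3}\simeq\pi^{\mathtt{bz}}\otimes\pi^{\mathtt{gy}}\simeq\pi^{\mathtt{gx}}\otimes\pi^{\mathtt{rz}}\simeq\pi^{\mathtt{bx}}\otimes\pi^{\mathtt{ry}},\\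 &\pi^{\mathtt f_4}\simeq\pi^{\mathtt{rz}}\otimes\pi^{\mathtt{gy}}\simeq\pi^{\mathtt{gx}}\otimes\pi^{\mathtt{bz}}\simeq\pi^{\mathtt{rx}}\otimes\pi^{\mathtt{by}},\\ &\pi^{\mathtt f_5}\simeq\pi^{\mathtt{rx}}\otimes\pi^{\mathtt{gy}}\simeq\pi^{\mathtt{bx}}\otimes\pi^{\mathtt{gz}}\simeq\pi^{\mathtt{by}}\otimes\pi^{\mathtt{rz}},\\ &\pi^{\mathtt f_6}\simeq\pi^{\mathtt{bx}}\otimes\pi^{\mathtt{gy}}\simeq\pi^{\mathtt{rx}}\otimes\pi^{\mathtt{gz}}\simeq\pi^{\mathtt{ry}}\otimes\pi^{\mathtt{bz}}. \end{aligned}$$ -/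

import Mathlib

open Filter Topology
open scoped symmDiff ComplexOrder

universe u v w

noncomputable section

namespace ColorCode

/-! ### The coloured brick-wall lattice -/

/-- The three colours red, green, blue. -/
inductive Color
  | r | g | b

/-- The three Pauli types. -/
inductive PauliType
  | x | y | z

/-- Vertices of the (brick-wall drawing of the) hexagonal lattice: the integer points of the
plane. One qubit sits on each vertex. -/
abbrev Vertex : Type := ℤ × ℤ

/-- The edges: all horizontal unit segments, and the vertical unit segments going up from the
vertices `(i, j)` with `i + j` even. Every vertex has exactly three neighbours. -/
def lattice : SimpleGraph Vertex :=
  SimpleGraph.fromRel fun u v =>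
    v = (u.1 + 1, u.2) ∨ (Even (u.1 + u.2) ∧ v = (u.1, u.2 + 1))

/-- The faces: the bricks `[i, i + 2] × [j, j + 1]` with `i + j` even, given by their lower left
corner `(i, j)`. -/
def Face : Type := {p : ℤ × ℤ // Even (p.1 + p.2)}

/-- The six vertices of a face. -/
def Face.boundary (f : Face) : Finset Vertex :=
  Finset.Icc f.1.1 (f.1.1 + 2) ×ˢ Finset.Icc f.1.2 (f.1.2 + 1)

/-- The colour of a face; any two adjacent faces have different colours. -/
def Face.color (f : Face) : Color :=
  if f.1.1 % 3 = 0 then .g else if f.1.1 % 3 = 1 then .r else .b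

/-- The position of a vertex in the Euclidean plane. -/
def Vertex.pos (v : Vertex) : EuclideanSpace ℝ (Fin 2) := !₂[(v.1 : ℝ), (v.2 : ℝ)]

/-- Cones: the sets of vertices in `{x | (x - p) · a > ‖x - p‖ cos θ}`, with apex `p`, axis the
unit vector `a` and half-opening angle `θ ∈ (0, π)`. -/
def IsCone (Λ : Set Vertex) : Prop :=
  ∃ (p a : EuclideanSpace ℝ (Fin 2)) (θ : ℝ), ‖a‖ = 1 ∧ 0 < θ ∧ θ < Real.pi ∧
    Λ = {v | ‖Vertex.pos v - p‖ * Real.cos θ < inner ℝ (Vertex.pos v - p) a}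

/-! ### Pauli operators -/

/-- The space `ℓ²` with orthonormal basis `|t⟩`, `t` a finite set of vertices. It is the infinite
tensor product of copies of `ℂ²` along the unit vectors `|0⟩`: the vector `|t⟩` has `|1⟩` at the
vertices of `t` and `|0⟩` elsewhere. It only serves to realise the quasi-local algebra. -/
abbrev Conf : Type := lp (fun _ : Finset Vertex => ℂ) 2

/-- The isometry `ψ ↦ (t ↦ φ t * ψ (e t))`. -/
def phasePerm (e : Equiv.Perm (Finset Vertex)) (φ : Finset Vertex → ℂ) (hφ : ∀ t, ‖φ t‖ = 1) :
    Conf →ₗᵢ[ℂ] Conf where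
  toFun ψ := ⟨fun t => φ t * ψ (e t), by
    have h := lp.memℓp ψ
    have h2 : 0 < (2 : ENNReal).toReal := by norm_num
    refine (memℓp_gen_iff h2).2 ?_
    have := (memℓp_gen_iff h2).1 h
    simpa [hφ, Function.comp_def] using (e.summable_iff.2 this)⟩
  map_add' ψ χ := by
    ext t
    exact mul_add (φ t) (ψ (e t)) (χ (e t))
  map_smul' c ψ := by
    ext t
    simp [mul_left_comm]
  norm_map' ψ := by
    have h2 : 0 < (2 : ENNReal).toReal := by norm_num
    rw [lp.norm_eq_tsum_rpow h2, lp.norm_eq_tsum_rpow h2]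
    congr 1
    simpa [hφ] using e.tsum_eq (fun t => ‖ψ t‖ ^ (2 : ℝ))

theorem phasePerm_apply (e : Equiv.Perm (Finset Vertex)) (φ : Finset Vertex → ℂ)
    (hφ : ∀ t, ‖φ t‖ = 1) (ψ : Conf) (t : Finset Vertex) :
    phasePerm e φ hφ ψ t = φ t * ψ (e t) := rfl

/-- `⊗_{v ∈ s} σ_v^x`, that is `|t⟩ ↦ |s ∆ t⟩`. -/
def pauliX (s : Finset Vertex) : Conf →L[ℂ] Conf :=
  (phasePerm (Function.Involutive.toPerm (fun t => s ∆ t) (fun t => symmDiff_symmDiff_cancel_left s t))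
    (fun _ => 1) (fun _ => by simp)).toContinuousLinearMap

/-- `⊗_{v ∈ s} σ_v^z`, that is `|t⟩ ↦ (-1)^{|s ∩ t|} |t⟩`. -/
def pauliZ (s : Finset Vertex) : Conf →L[ℂ] Conf :=
  (phasePerm (Equiv.refl _) (fun t => (-1) ^ (s ∩ t).card) (fun _ => by simp)).toContinuousLinearMap

theorem pauliX_apply (s : Finset Vertex) (ψ : Conf) (t : Finset Vertex) :
    pauliX s ψ t = ψ (s ∆ t) := by
  change (1 : ℂ) * ψ (s ∆ t) = _
  rw [one_mul]

theorem pauliZ_apply (s : Finset Vertex) (ψ : Conf) (t : Finset Vertex) :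
    pauliZ s ψ t = (-1) ^ (s ∩ t).card * ψ t := rfl

theorem pauliX_mul (s t : Finset Vertex) : pauliX s * pauliX t = pauliX (s ∆ t) := by
  ext ψ u
  simp only [mul_apply_eq_comp, pauliX_apply]
  rw [← symmDiff_assoc, symmDiff_comm t s]

theorem neg_one_pow_symmDiff (a b : Finset Vertex) :
    (-1 : ℂ) ^ (a ∆ b).card = (-1) ^ a.card * (-1) ^ b.card := by
  have h1 : (a ∆ b).card + 2 * (a ∩ b).card = a.card + b.card := by
    have e1 := Finset.card_sdiff_add_card_inter a b
    have e2 := Finset.card_sdiff_add_card_inter b a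
    have e3 : (a ∆ b).card = (a \ b).card + (b \ a).card := by
      rw [symmDiff_def, Finset.sup_eq_union, Finset.card_union_of_disjoint disjoint_sdiff_sdiff]
    rw [Finset.inter_comm b a] at e2
    omega
  rw [← pow_add, ← h1, pow_add, pow_mul]
  simp

theorem pauliZ_mul (s t : Finset Vertex) : pauliZ s * pauliZ t = pauliZ (s ∆ t) := by
  ext ψ u
  simp only [mul_apply_eq_comp, pauliZ_apply]
  have : (s ∆ t) ∩ u = (s ∩ u) ∆ (t ∩ u) := by
    ext x; simp only [Finset.mem_inter, Finset.mem_symmDiff]; tauto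
  rw [this, neg_one_pow_symmDiff, mul_assoc]

theorem pauliZ_mul_pauliX (s t : Finset Vertex) :
    pauliZ s * pauliX t = (-1 : ℂ) ^ (s ∩ t).card • (pauliX t * pauliZ s) := by
  ext ψ u
  simp only [mul_apply_eq_comp, smul_apply, lp.coeFn_smul,
    Pi.smul_apply, pauliZ_apply, pauliX_apply, smul_eq_mul]
  have : s ∩ (t ∆ u) = (s ∩ t) ∆ (s ∩ u) := by
    ext x; simp only [Finset.mem_inter, Finset.mem_symmDiff]; tauto
  rw [this, neg_one_pow_symmDiff, ← mul_assoc, ← mul_assoc, ← pow_add, ← two_mul, pow_mul]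
  simp

theorem pauliX_empty : pauliX ∅ = 1 := by
  ext ψ u
  rw [pauliX_apply, ← Finset.bot_eq_empty, bot_symmDiff]
  rfl

theorem pauliZ_empty : pauliZ ∅ = 1 := by
  ext ψ u
  simp [pauliZ_apply]

theorem star_pauliX (s : Finset Vertex) : star (pauliX s) = pauliX s := by
  have h : star (pauliX s) * pauliX s = 1 := by
    rw [ContinuousLinearMap.star_eq_adjoint]
    exact (ContinuousLinearMap.norm_map_iff_adjoint_comp_self _).1
      (fun ψ => LinearIsometry.norm_map _ ψ)
  calc star (pauliX s) = star (pauliX s) * (pauliX s * pauliX s) := by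
        rw [pauliX_mul, symmDiff_self, Finset.bot_eq_empty, pauliX_empty, mul_one]
    _ = pauliX s := by rw [← mul_assoc, h, one_mul]

theorem star_pauliZ (s : Finset Vertex) : star (pauliZ s) = pauliZ s := by
  have h : star (pauliZ s) * pauliZ s = 1 := by
    rw [ContinuousLinearMap.star_eq_adjoint]
    exact (ContinuousLinearMap.norm_map_iff_adjoint_comp_self _).1
      (fun ψ => LinearIsometry.norm_map _ ψ)
  calc star (pauliZ s) = star (pauliZ s) * (pauliZ s * pauliZ s) := by
        rw [pauliZ_mul, symmDiff_self, Finset.bot_eq_empty, pauliZ_empty, mul_one]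
    _ = pauliZ s := by rw [← mul_assoc, h, one_mul]

/-! ### The quasi-local algebra -/

/-- The algebra `𝒜(Λ)` of observables localised in `Λ`: the C⋆-algebra generated by the Pauli
matrices `σ_v^x`, `σ_v^z` at the vertices `v ∈ Λ`. As these generate the matrix algebra `M₂(ℂ)` of
the qubit at `v`, for finite `Λ` this is `⊗_{v ∈ Λ} M₂(ℂ)`, and for infinite `Λ` it is the norm
closure of the union of the algebras of the finite subsets of `Λ`. -/
def localAlgebra (Λ : Set Vertex) : StarSubalgebra ℂ (Conf →L[ℂ] Conf) :=
  (StarAlgebra.adjoin ℂ {T | ∃ v ∈ Λ, T = pauliX {v} ∨ T = pauliZ {v}}).topologicalClosure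

/-- The quasi-local algebra. -/
abbrev QLA : Type := localAlgebra Set.univ

instance isClosed_localAlgebra (Λ : Set Vertex) :
    IsClosed (localAlgebra Λ : Set (Conf →L[ℂ] Conf)) :=
  StarSubalgebra.isClosed_topologicalClosure _

instance : CompleteSpace QLA := (isClosed_localAlgebra Set.univ).completeSpace_coe

theorem singleX_mem {Λ : Set Vertex} {v : Vertex} (hv : v ∈ Λ) : pauliX {v} ∈ localAlgebra Λ :=
  StarSubalgebra.le_topologicalClosure _ (StarAlgebra.subset_adjoin ℂ _ ⟨v, hv, Or.inl rfl⟩)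

theorem singleZ_mem {Λ : Set Vertex} {v : Vertex} (hv : v ∈ Λ) : pauliZ {v} ∈ localAlgebra Λ :=
  StarSubalgebra.le_topologicalClosure _ (StarAlgebra.subset_adjoin ℂ _ ⟨v, hv, Or.inr rfl⟩)

theorem symmDiff_singleton {v : Vertex} {s : Finset Vertex} (h : v ∉ s) :
    ({v} : Finset Vertex) ∆ s = insert v s := by
  ext x
  simp only [Finset.mem_symmDiff, Finset.mem_singleton, Finset.mem_insert]
  constructor
  · tauto
  · rintro (rfl | hx)
    · exact Or.inl ⟨rfl, h⟩
    · exact Or.inr ⟨hx, fun e => h (e ▸ hx)⟩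

theorem pauliX_mem (s : Finset Vertex) : pauliX s ∈ localAlgebra Set.univ := by
  induction s using Finset.induction_on with
  | empty => rw [pauliX_empty]; exact one_mem _
  | insert v s hv ih =>
    rw [← symmDiff_singleton hv, ← pauliX_mul]
    exact mul_mem (singleX_mem (Set.mem_univ v)) ih

theorem pauliZ_mem (s : Finset Vertex) : pauliZ s ∈ localAlgebra Set.univ := by
  induction s using Finset.induction_on with
  | empty => rw [pauliZ_empty]; exact one_mem _
  | insert v s hv ih =>
    rw [← symmDiff_singleton hv, ← pauliZ_mul]
    exact mul_mem (singleZ_mem (Set.mem_univ v)) ih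

/-- `⊗_{v ∈ s} σ_v^x`, `⊗_{v ∈ s} σ_v^z` and their product `(⊗ σ_v^x) (⊗ σ_v^z)`, as elements of
the quasi-local algebra, for `k = x, z, y`. -/
def pauliString (k : PauliType) (s : Finset Vertex) : QLA :=
  match k with
  | .x => ⟨pauliX s, pauliX_mem s⟩
  | .z => ⟨pauliZ s, pauliZ_mem s⟩
  | .y => ⟨pauliX s, pauliX_mem s⟩ * ⟨pauliZ s, pauliZ_mem s⟩

/-- The stabilizer operator `K_f = ⊗_{v ∈ ∂f} σ_v^x`. -/
def stabK (f : Face) : QLA := pauliString .x f.boundary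

/-- The stabilizer operator `J_f = ⊗_{v ∈ ∂f} σ_v^z`. -/
def stabJ (f : Face) : QLA := pauliString .z f.boundary

/-! ### States and representations -/

/-- States on the quasi-local algebra: positive normalised linear functionals. -/
structure IsState (ω : QLA →ₗ[ℂ] ℂ) : Prop where
  nonneg : ∀ a, 0 ≤ ω (star a * a)
  map_one : ω 1 = 1

/-- The ground state condition: `ω` is a state with `ω(K_f) = ω(J_f) = 1` for all faces `f`.
This condition determines `ω` uniquely. -/
structure IsGroundState (ω : QLA →ₗ[ℂ] ℂ) : Prop extends IsState ω where
  map_stabK : ∀ f, ω (stabK f) = 1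
  map_stabJ : ∀ f, ω (stabJ f) = 1

theorem even_inter (f g : Face) : Even (f.boundary ∩ g.boundary).card := by
  obtain ⟨⟨i, j⟩, hf⟩ := f
  obtain ⟨⟨k, l⟩, hg⟩ := g
  have h : ∀ a b c d : ℤ, Finset.Icc a b ∩ Finset.Icc c d = Finset.Icc (max a c) (min b d) :=
    fun a b c d => by ext x; simp only [Finset.mem_inter, Finset.mem_Icc]; omega
  simp only [Face.boundary] at *
  rw [Finset.product_inter_product, Finset.card_product, h, h, Int.card_Icc, Int.card_Icc, Nat.even_mul]
  rw [Int.even_iff] at hf hg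
  rw [Nat.even_iff, Nat.even_iff]
  omega

/-- Every finite family of stabilizer conditions has a solution in `Conf`. -/
theorem exists_stabilized (F : Finset Face) : ∃ ψ : Conf,
    (∀ f ∈ F, pauliX f.boundary ψ = ψ) ∧ (∀ f : Face, pauliZ f.boundary ψ = ψ) ∧
      (∀ t, 0 ≤ ψ t) ∧ 0 < ψ ∅ := by
  classical
  induction F using Finset.induction_on with
  | empty =>
    refine ⟨lp.single 2 ∅ (1 : ℂ), by simp, fun f => ?_, fun t => ?_, ?_⟩
    · ext t
      rw [pauliZ_apply]
      by_cases ht : t = ∅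
      · subst ht; simp
      · rw [lp.single_apply_ne 2 _ _ ht, mul_zero]
    · by_cases ht : t = ∅
      · subst ht; rw [lp.single_apply_self]; exact zero_le_one
      · rw [lp.single_apply_ne 2 _ _ ht]
    · rw [lp.single_apply_self]; exact zero_lt_one
  | insert f F hf ih =>
    obtain ⟨ψ, hX, hZ, h0, h1⟩ := ih
    refine ⟨ψ + pauliX f.boundary ψ, fun g hg => ?_, fun g => ?_, fun t => ?_, ?_⟩
    · rcases Finset.mem_insert.1 hg with rfl | hg
      · rw [map_add, ← mul_apply_eq_comp, pauliX_mul, symmDiff_self, Finset.bot_eq_empty,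
          pauliX_empty, add_comm]
        rfl
      · rw [map_add, hX g hg, ← mul_apply_eq_comp, pauliX_mul, symmDiff_comm, ← pauliX_mul,
          mul_apply_eq_comp, hX g hg]
    · rw [map_add, hZ g, ← mul_apply_eq_comp, pauliZ_mul_pauliX, (even_inter g f).neg_one_pow,
        one_smul, mul_apply_eq_comp, hZ g]
    · exact add_nonneg (h0 t) (by rw [pauliX_apply]; exact h0 _)
    · exact add_pos_of_pos_of_nonneg h1 (by rw [pauliX_apply]; exact h0 _)

theorem exists_unit_stabilized (F : Finset Face) : ∃ ψ : Conf, ‖ψ‖ = 1 ∧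
    (∀ f ∈ F, pauliX f.boundary ψ = ψ) ∧ (∀ f : Face, pauliZ f.boundary ψ = ψ) := by
  obtain ⟨ψ, hX, hZ, -, h1⟩ := exists_stabilized F
  have hne : ψ ≠ 0 := by
    rintro rfl
    exact lt_irrefl _ h1
  refine ⟨((‖ψ‖ : ℂ)⁻¹) • ψ, ?_, fun f hf => ?_, fun f => ?_⟩
  · rw [norm_smul]
    simp [hne]
  · rw [map_smul, hX f hf]
  · rw [map_smul, hZ f]

/-- A limit point of the vector states of finite families of stabilizers is a ground state. -/
theorem exists_isGroundState : ∃ ω : QLA →ₗ[ℂ] ℂ, IsGroundState ω := by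
  classical
  choose ψ hn hX hZ using exists_unit_stabilized
  let U : Ultrafilter (Finset Face) := Ultrafilter.of atTop
  have hU : (U : Filter (Finset Face)) ≤ atTop := Ultrafilter.of_le atTop
  let e : QLA → Finset Face → ℂ := fun a F => inner ℂ (ψ F) ((a : Conf →L[ℂ] Conf) (ψ F))
  have hb : ∀ a F, ‖e a F‖ ≤ ‖(a : Conf →L[ℂ] Conf)‖ := fun a F => by
    refine (norm_inner_le_norm _ _).trans ?_
    have := (a : Conf →L[ℂ] Conf).le_opNorm (ψ F)
    rw [hn] at this ⊢
    simpa using this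
  have hlim : ∀ a, ∃ z, Tendsto (e a) U (𝓝 z) := fun a => by
    obtain ⟨z, -, hz⟩ := (isCompact_closedBall (0 : ℂ) ‖(a : Conf →L[ℂ] Conf)‖).ultrafilter_le_nhds
      (U.map (e a)) (by
        rw [le_principal_iff]
        exact Filter.mem_map.2 (Filter.univ_mem' fun F => by simpa using hb a F))
    exact ⟨z, hz⟩
  choose w hw using hlim
  have huniq : ∀ a z, Tendsto (e a) U (𝓝 z) → w a = z := fun a z hz =>
    tendsto_nhds_unique (hw a) hz
  refine ⟨{ toFun := w, map_add' := fun a b => ?_, map_smul' := fun c a => ?_ }, ?_⟩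
  · refine huniq _ _ (((hw a).add (hw b)).congr fun F => ?_)
    simp [e]
  · refine huniq _ _ (((hw a).const_mul c).congr fun F => ?_)
    simp [e]
  refine { nonneg := fun a => ?_, map_one := ?_, map_stabK := fun f => ?_, map_stabJ := fun f => ?_ }
  · refine ge_of_tendsto (hw (star a * a)) (Filter.univ_mem' fun F => ?_)
    change (0 : ℂ) ≤ inner ℂ (ψ F)
      ((star (a : Conf →L[ℂ] Conf) * (a : Conf →L[ℂ] Conf)) (ψ F))
    rw [mul_apply_eq_comp, ContinuousLinearMap.star_eq_adjoint,
      ContinuousLinearMap.adjoint_inner_right, inner_self_eq_norm_sq_to_K]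
    exact pow_nonneg (by simp) 2
  · refine huniq _ _ (tendsto_const_nhds.congr fun F => ?_)
    change (1 : ℂ) = inner ℂ (ψ F) (ψ F)
    rw [inner_self_eq_norm_sq_to_K, hn]
    simp
  · refine huniq _ _ (tendsto_const_nhds.congr' ?_)
    filter_upwards [hU (eventually_ge_atTop {f})] with F hF
    change (1 : ℂ) = inner ℂ (ψ F) (pauliX f.boundary (ψ F))
    rw [hX F f (hF (Finset.mem_singleton_self f)), inner_self_eq_norm_sq_to_K, hn]
    simp
  · refine huniq _ _ (tendsto_const_nhds.congr fun F => ?_)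
    change (1 : ℂ) = inner ℂ (ψ F) (pauliZ f.boundary (ψ F))
    rw [hZ F f, inner_self_eq_norm_sq_to_K, hn]
    simp

/-- The ground state `ω₀` of the colour code. -/
def groundState : QLA →ₗ[ℂ] ℂ := Classical.choose exists_isGroundState

theorem groundState_spec : IsGroundState groundState := Classical.choose_spec exists_isGroundState

/-- Representations of the quasi-local algebra on Hilbert spaces. -/
structure Rep where
  space : Type u
  [normed : NormedAddCommGroup space]
  [innerProduct : InnerProductSpace ℂ space]
  [complete : CompleteSpace space]
  hom : QLA →⋆ₐ[ℂ] (space →L[ℂ] space)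

attribute [instance] Rep.normed Rep.innerProduct Rep.complete

namespace Rep

/-- `π` is a GNS representation of the functional `ω`: there is a cyclic vector `Ω` with
`ω(A) = ⟨Ω, π(A) Ω⟩`. -/
def IsGNS (π : Rep.{u}) (ω : QLA →ₗ[ℂ] ℂ) : Prop :=
  ∃ Ω : π.space, (∀ a, ω a = inner ℂ Ω (π.hom a Ω)) ∧ Dense (Set.range fun a => π.hom a Ω)

/-- Unitary equivalence of the restrictions of two representations to `𝒜(Λ)`. -/
def EquivOn (Λ : Set Vertex) (π : Rep.{u}) (π' : Rep.{v}) : Prop :=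
  ∃ U : π.space ≃ₗᵢ[ℂ] π'.space, ∀ a : QLA, (a : Conf →L[ℂ] Conf) ∈ localAlgebra Λ →
    ∀ x, U (π.hom a x) = π'.hom a (U x)

/-- Unitary equivalence of representations. -/
def Equiv (π : Rep.{u}) (π' : Rep.{v}) : Prop :=
  ∃ U : π.space ≃ₗᵢ[ℂ] π'.space, ∀ a x, U (π.hom a x) = π'.hom a (U x)

/-- The representation `π ∘ ρ`. -/
def comp (π : Rep.{u}) (ρ : QLA →⋆ₐ[ℂ] QLA) : Rep.{u} where
  space := π.space
  hom := π.hom.comp ρ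

/-- The superselection criterion relative to `π₀`: for every cone `Λ`, the restriction of `π` to
`𝒜(Λᶜ)` is unitarily equivalent to that of `π₀`. -/
def IsSuperselectionSector (π₀ : Rep.{u}) (π : Rep.{v}) : Prop :=
  ∀ Λ, IsCone Λ → EquivOn Λᶜ π π₀

end Rep

/-! ### Strings and their endomorphisms -/

/-- Half-infinite strings `(f₀, v₀, v₁, f₁, v₂, v₃, f₂, …)` of colour `c`: the faces `f_n` have
colour `c`, and `v_{2n}`, `v_{2n+1}` are the ends of an edge that connects `f_n` to a different
face `f_{n+1}`. No vertex occurs twice. -/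
structure HalfInfiniteString (c : Color) where
  face : ℕ → Face
  vert : ℕ → Vertex
  color_face : ∀ n, (face n).color = c
  face_ne : ∀ n, face n ≠ face (n + 1)
  even_mem : ∀ n, vert (2 * n) ∈ (face n).boundary
  odd_mem : ∀ n, vert (2 * n + 1) ∈ (face (n + 1)).boundary
  adj : ∀ n, lattice.Adj (vert (2 * n)) (vert (2 * n + 1))
  vert_injective : Function.Injective vert

namespace HalfInfiniteString

variable {c : Color}

/-- The support of the string is contained in some cone. -/
def InCone (γ : HalfInfiniteString c) : Prop :=
  ∃ Λ, IsCone Λ ∧ Set.range γ.vert ⊆ Λ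

/-- The support of the finite string `γ_n = (f₀, v₀, v₁, f₁, …, v_{2n-1}, f_n)`. -/
def support (γ : HalfInfiniteString c) (n : ℕ) : Finset Vertex :=
  (Finset.range (2 * n)).image γ.vert

/-- The string operator `S_{γ_n}^{ck}`. -/
def stringOp (γ : HalfInfiniteString c) (k : PauliType) (n : ℕ) : QLA :=
  pauliString k (γ.support n)

theorem mem_support_eventually (γ : HalfInfiniteString c) (v : Vertex) :
    ∃ N, ∀ n, N ≤ n → (v ∈ γ.support n ↔ v ∈ γ.support N) := by
  by_cases h : ∃ m, γ.vert m = v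
  · obtain ⟨m, rfl⟩ := h
    refine ⟨m + 1, fun n hn => ?_⟩
    have : ∀ n, m + 1 ≤ n → γ.vert m ∈ γ.support n := fun n hn =>
      Finset.mem_image_of_mem _ (Finset.mem_range.2 (by omega))
    exact iff_of_true (this n hn) (this _ le_rfl)
  · refine ⟨0, fun n _ => ?_⟩
    have : ∀ n, v ∉ γ.support n := fun n hv => by
      obtain ⟨m, -, hm⟩ := Finset.mem_image.1 hv
      exact h ⟨m, hm⟩
    exact iff_of_false (this n) (this _)

end HalfInfiniteString

theorem pauliString_mem_unitary (k : PauliType) (s : Finset Vertex) :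
    pauliString k s ∈ unitary QLA := by
  have hX : (⟨pauliX s, pauliX_mem s⟩ : QLA) ∈ unitary QLA := by
    rw [Unitary.mem_iff]
    constructor <;>
    · apply Subtype.ext
      change _ * _ = (1 : Conf →L[ℂ] Conf)
      simp [star_pauliX, pauliX_mul, ← pauliX_empty]
  have hZ : (⟨pauliZ s, pauliZ_mem s⟩ : QLA) ∈ unitary QLA := by
    rw [Unitary.mem_iff]
    constructor <;>
    · apply Subtype.ext
      change _ * _ = (1 : Conf →L[ℂ] Conf)
      simp [star_pauliZ, pauliZ_mul, ← pauliZ_empty]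
  cases k
  · exact hX
  · exact mul_mem hX hZ
  · exact hZ

theorem conj_XX (s t : Finset Vertex) : pauliX s * pauliX t * pauliX s = pauliX t := by
  rw [pauliX_mul, pauliX_mul, symmDiff_comm s t, symmDiff_symmDiff_cancel_right]

theorem conj_ZZ (s t : Finset Vertex) : pauliZ s * pauliZ t * pauliZ s = pauliZ t := by
  rw [pauliZ_mul, pauliZ_mul, symmDiff_comm s t, symmDiff_symmDiff_cancel_right]

theorem conj_ZX (s t : Finset Vertex) :
    pauliZ s * pauliX t * pauliZ s = (-1 : ℂ) ^ (s ∩ t).card • pauliX t := by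
  rw [pauliZ_mul_pauliX, smul_mul_assoc, mul_assoc, pauliZ_mul, symmDiff_self,
    Finset.bot_eq_empty, pauliZ_empty, mul_one]

theorem conj_XZ (s t : Finset Vertex) :
    pauliX s * pauliZ t * pauliX s = (-1 : ℂ) ^ (t ∩ s).card • pauliZ t := by
  rw [mul_assoc, pauliZ_mul_pauliX, mul_smul_comm, ← mul_assoc, pauliX_mul, symmDiff_self,
    Finset.bot_eq_empty, pauliX_empty, one_mul]

theorem conj_Y (s : Finset Vertex) (T : Conf →L[ℂ] Conf) :
    star (pauliX s * pauliZ s) * T * (pauliX s * pauliZ s) =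
      pauliZ s * (pauliX s * T * pauliX s) * pauliZ s := by
  rw [star_mul, star_pauliX, star_pauliZ]
  simp only [mul_assoc]

/-- Conjugating a generator at `v` by the Pauli operator on `s` only depends on whether
`v ∈ s`. -/
theorem conj_generator_congr (k : PauliType) {s s' : Finset Vertex} {v : Vertex}
    (h : v ∈ s ↔ v ∈ s') {T : Conf →L[ℂ] Conf} (hT : T = pauliX {v} ∨ T = pauliZ {v}) :
    star (pauliString k s : Conf →L[ℂ] Conf) * T * (pauliString k s : Conf →L[ℂ] Conf) =
      star (pauliString k s' : Conf →L[ℂ] Conf) * T * (pauliString k s' : Conf →L[ℂ] Conf) := by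
  have h1 : s ∩ {v} = s' ∩ {v} := by
    ext x
    simp only [Finset.mem_inter, Finset.mem_singleton]
    constructor
    · rintro ⟨hx, rfl⟩; exact ⟨h.1 hx, rfl⟩
    · rintro ⟨hx, rfl⟩; exact ⟨h.2 hx, rfl⟩
  have h2 : {v} ∩ s = {v} ∩ s' := by rw [Finset.inter_comm, h1, Finset.inter_comm]
  cases k
  · change star (pauliX s) * T * pauliX s = star (pauliX s') * T * pauliX s'
    rw [star_pauliX, star_pauliX]
    rcases hT with rfl | rfl
    · rw [conj_XX, conj_XX]
    · rw [conj_XZ, conj_XZ, h2]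
  · change star (pauliX s * pauliZ s) * T * (pauliX s * pauliZ s) =
      star (pauliX s' * pauliZ s') * T * (pauliX s' * pauliZ s')
    rw [conj_Y, conj_Y]
    rcases hT with rfl | rfl
    · rw [conj_XX, conj_XX, conj_ZX, conj_ZX, h1]
    · rw [conj_XZ, conj_XZ, mul_smul_comm, smul_mul_assoc, conj_ZZ, mul_smul_comm,
        smul_mul_assoc, conj_ZZ, h2]
  · change star (pauliZ s) * T * pauliZ s = star (pauliZ s') * T * pauliZ s'
    rw [star_pauliZ, star_pauliZ]
    rcases hT with rfl | rfl
    · rw [conj_ZX, conj_ZX, h1]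
    · rw [conj_ZZ, conj_ZZ]

/-- For a sequence of unitaries, the operators whose conjugates converge form a closed
⋆-subalgebra. -/
def convergenceAlgebra (u : ℕ → unitary (Conf →L[ℂ] Conf)) :
    StarSubalgebra ℂ (Conf →L[ℂ] Conf) where
  carrier := {T | ∃ L, Tendsto (fun n => star (u n : Conf →L[ℂ] Conf) * T * u n) atTop (𝓝 L)}
  mul_mem' := by
    rintro S T ⟨L, hL⟩ ⟨M, hM⟩
    refine ⟨L * M, (hL.mul hM).congr fun n => ?_⟩
    have h : (u n : Conf →L[ℂ] Conf) * star (u n : Conf →L[ℂ] Conf) = 1 :=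
      Unitary.mul_star_self_of_mem (u n).2
    calc _ = star (u n : Conf →L[ℂ] Conf) * S * ((u n : Conf →L[ℂ] Conf) *
          star (u n : Conf →L[ℂ] Conf)) * T * u n := by simp only [mul_assoc]
      _ = _ := by rw [h, mul_one]; simp only [mul_assoc]
  add_mem' := by
    rintro S T ⟨L, hL⟩ ⟨M, hM⟩
    exact ⟨L + M, (hL.add hM).congr fun n => by rw [mul_add, add_mul]⟩
  algebraMap_mem' r := by
    refine ⟨algebraMap ℂ _ r, tendsto_const_nhds.congr fun n => ?_⟩
    have h : star (u n : Conf →L[ℂ] Conf) * (u n : Conf →L[ℂ] Conf) = 1 :=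
      Unitary.star_mul_self_of_mem (u n).2
    rw [← Algebra.commutes, mul_assoc, h, mul_one]
  star_mem' := by
    rintro T ⟨L, hL⟩
    exact ⟨star L, hL.star.congr fun n => by simp only [star_mul, star_star, mul_assoc]⟩

theorem isClosed_convergenceAlgebra (u : ℕ → unitary (Conf →L[ℂ] Conf)) :
    IsClosed (convergenceAlgebra u : Set (Conf →L[ℂ] Conf)) := by
  have hnorm : ∀ n (T : Conf →L[ℂ] Conf), ‖star (u n : Conf →L[ℂ] Conf) * T * u n‖ = ‖T‖ :=
    fun n T => by
      rw [CStarRing.norm_mul_coe_unitary, ← Unitary.coe_star, CStarRing.norm_coe_unitary_mul]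
  refine isClosed_of_closure_subset fun T hT => ?_
  refine cauchySeq_tendsto_of_complete (Metric.cauchySeq_iff'.2 fun ε hε => ?_)
  obtain ⟨S, ⟨L, hL⟩, hS⟩ := Metric.mem_closure_iff.1 hT (ε / 3) (by positivity)
  obtain ⟨N, hN⟩ := Metric.cauchySeq_iff'.1 hL.cauchySeq (ε / 3) (by positivity)
  have key : ∀ n, dist (star (u n : Conf →L[ℂ] Conf) * T * u n)
      (star (u n : Conf →L[ℂ] Conf) * S * u n) = dist T S := fun n => by
    rw [dist_eq_norm, dist_eq_norm, ← sub_mul, ← mul_sub, hnorm]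
  refine ⟨N, fun n hn => ?_⟩
  have h1 := dist_triangle4 (star (u n : Conf →L[ℂ] Conf) * T * u n)
    (star (u n : Conf →L[ℂ] Conf) * S * u n) (star (u N : Conf →L[ℂ] Conf) * S * u N)
    (star (u N : Conf →L[ℂ] Conf) * T * u N)
  have h2 := hN n hn
  rw [key, dist_comm (star (u N : Conf →L[ℂ] Conf) * S * u N), key] at h1
  linarith

namespace HalfInfiniteString

variable {c : Color}

theorem exists_tendsto (γ : HalfInfiniteString c) (k : PauliType) (a : QLA) :
    ∃ b : QLA, Tendsto (fun n => star (γ.stringOp k n) * a * γ.stringOp k n) atTop (𝓝 b) := by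
  have hmem : ∀ n, (γ.stringOp k n : Conf →L[ℂ] Conf) ∈ unitary (Conf →L[ℂ] Conf) := fun n => by
    have h := Unitary.mem_iff.1 (pauliString_mem_unitary k (γ.support n))
    exact Unitary.mem_iff.2 ⟨congrArg Subtype.val h.1, congrArg Subtype.val h.2⟩
  let u : ℕ → unitary (Conf →L[ℂ] Conf) := fun n => ⟨γ.stringOp k n, hmem n⟩
  have hle : localAlgebra Set.univ ≤ convergenceAlgebra u := by
    refine StarSubalgebra.topologicalClosure_minimal (StarAlgebra.adjoin_le ?_)
      (isClosed_convergenceAlgebra u)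
    rintro T ⟨v, -, hT⟩
    obtain ⟨N, hN⟩ := γ.mem_support_eventually v
    refine ⟨star (u N : Conf →L[ℂ] Conf) * T * u N, tendsto_const_nhds.congr' ?_⟩
    filter_upwards [eventually_ge_atTop N] with n hn
    exact (conj_generator_congr k (hN n hn) hT).symm
  obtain ⟨L, hL⟩ := hle a.2
  refine cauchySeq_tendsto_of_complete ?_
  have h : CauchySeq fun n =>
      ((star (γ.stringOp k n) * a * γ.stringOp k n : QLA) : Conf →L[ℂ] Conf) := hL.cauchySeq
  exact (isometry_subtype_coe.isUniformInducing.cauchy_map_iff).1 (by rw [map_map]; exact h)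

theorem star_mul_stringOp (γ : HalfInfiniteString c) (k : PauliType) (n : ℕ) :
    star (γ.stringOp k n) * γ.stringOp k n = 1 :=
  Unitary.star_mul_self_of_mem (pauliString_mem_unitary k (γ.support n))

/-- `ρ_γ^{ck}(A) = lim_n (S_{γ_n}^{ck})⋆ A S_{γ_n}^{ck}`. -/
def endoFun (γ : HalfInfiniteString c) (k : PauliType) (a : QLA) : QLA :=
  limUnder atTop fun n => star (γ.stringOp k n) * a * γ.stringOp k n

theorem tendsto_endoFun (γ : HalfInfiniteString c) (k : PauliType) (a : QLA) :
    Tendsto (fun n => star (γ.stringOp k n) * a * γ.stringOp k n) atTop (𝓝 (γ.endoFun k a)) :=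
  tendsto_nhds_limUnder (γ.exists_tendsto k a)

theorem endoFun_eq (γ : HalfInfiniteString c) (k : PauliType) {a b : QLA}
    (h : Tendsto (fun n => star (γ.stringOp k n) * a * γ.stringOp k n) atTop (𝓝 b)) :
    γ.endoFun k a = b :=
  tendsto_nhds_unique (γ.tendsto_endoFun k a) h

/-- The endomorphism `ρ_γ^{ck}` of the quasi-local algebra, `A ↦ ρ_γ^{ck}(A)`. -/
def endo (γ : HalfInfiniteString c) (k : PauliType) : QLA →⋆ₐ[ℂ] QLA where
  toFun := γ.endoFun k
  map_one' := γ.endoFun_eq k (tendsto_const_nhds.congr fun n => by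
    rw [mul_one, star_mul_stringOp])
  map_zero' := γ.endoFun_eq k (tendsto_const_nhds.congr fun n => by rw [mul_zero, zero_mul])
  map_mul' a b := γ.endoFun_eq k (((γ.tendsto_endoFun k a).mul (γ.tendsto_endoFun k b)).congr
    fun n => by
      have h : γ.stringOp k n * star (γ.stringOp k n) = 1 :=
        Unitary.mul_star_self_of_mem (pauliString_mem_unitary k (γ.support n))
      calc _ = star (γ.stringOp k n) * a * (γ.stringOp k n * star (γ.stringOp k n)) * b *
            γ.stringOp k n := by simp only [mul_assoc]
        _ = _ := by rw [h, mul_one]; simp only [mul_assoc])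
  map_add' a b := γ.endoFun_eq k (((γ.tendsto_endoFun k a).add (γ.tendsto_endoFun k b)).congr
    fun n => by rw [mul_add, add_mul])
  commutes' r := γ.endoFun_eq k (tendsto_const_nhds.congr fun n => by
    rw [← Algebra.commutes, mul_assoc, star_mul_stringOp, mul_one])
  map_star' a := γ.endoFun_eq k ((γ.tendsto_endoFun k a).star.congr
    fun n => by simp only [star_mul, star_star, mul_assoc])

end HalfInfiniteString

/-- The vertical half-infinite string that starts at the face `f` and goes up. -/
def verticalString {c : Color} (f : Face) (hf : f.color = c) : HalfInfiniteString c where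
  face n := ⟨(f.1.1, f.1.2 + 2 * n), by
    have := f.2
    rw [Int.even_iff] at this ⊢
    dsimp only
    omega⟩
  vert m := (f.1.1 + 1, f.1.2 + 1 + m)
  color_face n := hf
  face_ne n h := by
    have := congrArg (fun g : Face => g.1.2) h
    dsimp only at this
    push_cast at this
    omega
  even_mem n := by
    simp only [Face.boundary, Finset.mem_product, Finset.mem_Icc]
    push_cast
    omega
  odd_mem n := by
    simp only [Face.boundary, Finset.mem_product, Finset.mem_Icc]
    push_cast
    omega
  adj n := by
    have := f.2
    rw [Int.even_iff] at this
    rw [lattice, SimpleGraph.fromRel_adj]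
    refine ⟨fun h => ?_, Or.inl (Or.inr ⟨?_, ?_⟩)⟩
    · have := congrArg Prod.snd h
      dsimp only at this
      push_cast at this
      omega
    · rw [Int.even_iff]
      push_cast
      omega
    · refine Prod.ext rfl ?_
      dsimp only
      push_cast
      ring
  vert_injective m n h := by
    have := congrArg Prod.snd h
    dsimp only at this
    omega

/-- Three mutually adjacent faces, one of each colour. -/
def baseFace : Color → Face
  | .g => ⟨(0, 0), by decide⟩
  | .r => ⟨(1, -1), by decide⟩
  | .b => ⟨(2, 0), by decide⟩

theorem baseFace_color (c : Color) : (baseFace c).color = c := by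
  cases c <;> rfl

/-- The vertical strings `γ_c` of the three colours from three mutually adjacent faces. -/
def baseString (c : Color) : HalfInfiniteString c := 
  verticalString (baseFace c) (baseFace_color c)

/-! ### Sectors and fusion -/

/-- The functional `ω ∘ ρ`. -/
def pullback (ω : QLA →ₗ[ℂ] ℂ) (ρ : QLA →⋆ₐ[ℂ] QLA) : QLA →ₗ[ℂ] ℂ :=
  ω ∘ₗ ρ.toAlgHom.toLinearMap

/-- `π` is a version of `π^{ck}`: a GNS representation of the state `ω₀ ∘ ρ_γ^{ck}` for some
half-infinite string `γ` of colour `c` contained in a cone. -/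
def IsBosonSector (c : Color) (k : PauliType) (π : Rep.{u}) : Prop :=
  ∃ γ : HalfInfiniteString c, γ.InCone ∧ π.IsGNS (pullback groundState (γ.endo k))

/-- The six fermions. -/
inductive Fermion
  | f1 | f2 | f3 | f4 | f5 | f6

/-- The state `ω^{ck,c'k'} = ω₀ ∘ ρ_{γ_c}^{ck} ∘ ρ_{γ_{c'}}^{c'k'}`. -/
def pairState (c : Color) (k : PauliType) (c' : Color) (k' : PauliType) : QLA →ₗ[ℂ] ℂ :=
  pullback groundState (((baseString c).endo k).comp ((baseString c').endo k'))

/-- The states whose GNS representations are the fermionic sectors `π^{f_j}`. -/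
def fermionState : Fermion → QLA →ₗ[ℂ] ℂ
  | .f1 => pairState .r .x .b .z
  | .f2 => pairState .r .z .b .x
  | .f3 => pairState .b .z .g .y
  | .f4 => pairState .r .z .g .y
  | .f5 => pairState .r .x .g .y
  | .f6 => pairState .b .x .g .y

/-- The tensor product of two endomorphisms is their composition, `(ρ ⊗ ρ')(A) = ρ(ρ'(A))`. -/
def tensor (ρ ρ' : QLA →⋆ₐ[ℂ] QLA) : QLA →⋆ₐ[ℂ] QLA := ρ.comp ρ'

/-- `π ≃ π^{ck} ⊗ π^{c'k'}`, where `B` is the family of the sectors `π^{ck}`: for all half-infinite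
strings `γ`, `γ'` of colours `c`, `c'` contained in cones, the endomorphisms `ρ = ρ_γ^{ck}` and
`ρ' = ρ_{γ'}^{c'k'}` represent `π^{ck}` and `π^{c'k'}`, and their tensor product represents `π`. -/
def IsFusion (π₀ : Rep.{u}) (B : Color → PauliType → Rep.{v}) (π : Rep.{w})
    (c : Color) (k : PauliType) (c' : Color) (k' : PauliType) : Prop :=
  ∀ γ : HalfInfiniteString c, γ.InCone → ∀ γ' : HalfInfiniteString c', γ'.InCone →
    (B c k).Equiv (π₀.comp (γ.endo k)) ∧
    (B c' k').Equiv (π₀.comp (γ'.endo k')) ∧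
    π.Equiv (π₀.comp (tensor (γ.endo k) (γ'.endo k')))

end ColorCode

end

open ColorCode

noncomputable section

namespace ColorCode

/-! ### Pauli operators in the quasi-local algebra -/

/-! Every string endomorphism is formally the conjugation by a possibly infinite Pauli operator,
with σ^x on a chain S and σ^z on a chain T, both functions from the vertices to ℤ/2. Such Pauli
endomorphisms compose by adding chains, so fusion becomes addition. The syndrome `bd S` records the
parity of S on each face, that is, which stabilizers change sign; the charge of S is its syndrome
modulo the syndromes of finite chains.

The central fact is `comp_pauliEndo_equiv`: the class of π₀ ∘ ρ_{S,T} depends only on the charges of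
S and T. Finite chains give inner automorphisms. If both syndromes vanish, ρ_{S,T} fixes all
stabilizers and therefore ω₀, because ω₀ is determined by its stabilizer values: a finite Pauli
operator with nonzero syndrome anticommutes with some stabilizer and has expectation 0, while one
with zero syndrome is, up to its σ^x and σ^z factors, a product of stabilizers and has expectation
1. The last point is the exactness statement `mem_faceGroup_of_bd_eq_zero`: a finite closed chain is
a sum of faces. Uniqueness of the GNS representation finishes the argument.

A half-infinite string has exactly its first face as syndrome. Edges transport an excitation between
faces of equal colour, so its charge depends on the colour only; a single vertex excites one face of
each colour, whence r + g + b = 0, and every charge has order at most two. With pairs (σ^x charge,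
σ^z charge), the fermions f₁, …, f₆ are (r,b), (b,r), (g,r), (g,b), (b,g), (r,g), and each fusion
relation is an identity between such pairs.

For the superselection criterion, each cone contains a chain with the charge of any given colour
(`IsCone.exists_charge_eq`). Representing a sector by chains inside the cone gives an endomorphism
that acts trivially on the observables outside it. -/

/-- `⊗_{v ∈ s} σ_v^x` as an element of the quasi-local algebra. -/
def opX (s : Finset Vertex) : QLA := ⟨pauliX s, pauliX_mem s⟩

/-- `⊗_{v ∈ s} σ_v^z` as an element of the quasi-local algebra. -/
def opZ (s : Finset Vertex) : QLA := ⟨pauliZ s, pauliZ_mem s⟩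

theorem opX_mul (s t : Finset Vertex) : opX s * opX t = opX (s ∆ t) :=
  Subtype.ext (pauliX_mul s t)

theorem opZ_mul (s t : Finset Vertex) : opZ s * opZ t = opZ (s ∆ t) :=
  Subtype.ext (pauliZ_mul s t)

theorem opX_empty : opX ∅ = 1 := Subtype.ext pauliX_empty

theorem opZ_empty : opZ ∅ = 1 := Subtype.ext pauliZ_empty

theorem opX_mem_unitary (s : Finset Vertex) : opX s ∈ unitary QLA :=
  pauliString_mem_unitary .x s

theorem opZ_mem_unitary (s : Finset Vertex) : opZ s ∈ unitary QLA :=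
  pauliString_mem_unitary .z s

theorem conj_opX (s t r : Finset Vertex) :
    star (opX s * opZ t) * opX r * (opX s * opZ t) = (-1 : ℂ) ^ (t ∩ r).card • opX r := by
  refine Subtype.ext ?_
  change star (pauliX s * pauliZ t) * pauliX r * (pauliX s * pauliZ t) = _ • pauliX r
  rw [star_mul, star_pauliX, star_pauliZ, ← conj_ZX]
  conv_rhs => rw [← conj_XX s r]
  simp only [mul_assoc]

theorem conj_opZ (s t r : Finset Vertex) :
    star (opX s * opZ t) * opZ r * (opX s * opZ t) = (-1 : ℂ) ^ (r ∩ s).card • opZ r := by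
  refine Subtype.ext ?_
  change star (pauliX s * pauliZ t) * pauliZ r * (pauliX s * pauliZ t) = _ • pauliZ r
  rw [star_mul, star_pauliX, star_pauliZ]
  calc _ = pauliZ t * (pauliX s * pauliZ r * pauliX s) * pauliZ t := by simp only [mul_assoc]
    _ = _ := by rw [conj_XZ, mul_smul_comm, smul_mul_assoc, conj_ZZ]

/-- Moving σ^z past σ^x only costs a sign. This is what makes the span of the Pauli operators an
algebra. -/
theorem pauli_mul_pauli (s t s' t' : Finset Vertex) :
    pauliX s * pauliZ t * (pauliX s' * pauliZ t') =
      (-1 : ℂ) ^ (t ∩ s').card • (pauliX (s ∆ s') * pauliZ (t ∆ t')) := by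
  rw [← pauliX_mul, ← pauliZ_mul]
  calc _ = pauliX s * (pauliZ t * pauliX s') * pauliZ t' := by simp only [mul_assoc]
    _ = _ := by
      rw [pauliZ_mul_pauliX, mul_smul_comm, smul_mul_assoc]
      simp only [mul_assoc]

/-- The linear span of the Pauli operators is a ⋆-algebra. -/
def pauliSpan : StarSubalgebra ℂ (Conf →L[ℂ] Conf) :=
  { (Submodule.span ℂ (Set.range fun p : Finset Vertex × Finset Vertex =>
      pauliX p.1 * pauliZ p.2)).toSubalgebra
      (Submodule.subset_span ⟨(∅, ∅), by simp [pauliX_empty, pauliZ_empty]⟩)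
      (fun a b ha hb => by
        have h := Submodule.mul_mem_mul ha hb
        rw [Submodule.span_mul_span] at h
        refine Submodule.span_le.2 ?_ h
        rintro _ ⟨_, ⟨p, rfl⟩, _, ⟨q, rfl⟩, rfl⟩
        change _ * _ * (_ * _) ∈ _
        rw [pauli_mul_pauli]
        exact Submodule.smul_mem _ _ (Submodule.subset_span ⟨(p.1 ∆ q.1, p.2 ∆ q.2), rfl⟩)) with
    star_mem' := fun {a} ha => by
      induction ha using Submodule.span_induction with
      | mem x hx =>
        obtain ⟨p, rfl⟩ := hx
        change star (_ * _) ∈ Submodule.span _ _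
        rw [star_mul, star_pauliX, star_pauliZ, pauliZ_mul_pauliX]
        exact Submodule.smul_mem _ _ (Submodule.subset_span ⟨p, rfl⟩)
      | zero => rw [star_zero]; exact Submodule.zero_mem _
      | add x y _ _ hx hy => rw [star_add]; exact Submodule.add_mem _ hx hy
      | smul c x _ hx => rw [star_smul]; exact Submodule.smul_mem _ _ hx }

theorem localAlgebra_le_closure_pauliSpan :
    localAlgebra Set.univ ≤ pauliSpan.topologicalClosure := by
  refine StarSubalgebra.topologicalClosure_mono (StarAlgebra.adjoin_le ?_)
  rintro T ⟨v, -, rfl | rfl⟩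
  · exact Submodule.subset_span ⟨({v}, ∅), by simp [pauliZ_empty]⟩
  · exact Submodule.subset_span ⟨(∅, {v}), by simp [pauliX_empty]⟩

/-- A closed subspace that contains the Pauli operators is everything. -/
theorem mem_of_opX_mul_opZ_mem (P : Submodule ℂ QLA) (hP : IsClosed (P : Set QLA))
    (h : ∀ s t, opX s * opZ t ∈ P) (a : QLA) : a ∈ P := by
  have hcl : IsClosed ((↑) '' (P : Set QLA) : Set (Conf →L[ℂ] Conf)) :=
    (isClosed_localAlgebra Set.univ).isClosedEmbedding_subtypeVal.isClosedMap _ hP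
  have hsub : (pauliSpan : Set (Conf →L[ℂ] Conf)) ⊆ (↑) '' (P : Set QLA) := by
    intro T hT
    change T ∈ P.map ((localAlgebra Set.univ).toSubalgebra.toSubmodule.subtype)
    refine (Submodule.span_le (p := P.map _)).2 ?_ hT
    rintro _ ⟨p, rfl⟩
    exact ⟨_, h p.1 p.2, rfl⟩
  have h1 : (a : Conf →L[ℂ] Conf) ∈ closure (pauliSpan : Set (Conf →L[ℂ] Conf)) :=
    localAlgebra_le_closure_pauliSpan a.2
  obtain ⟨b, hb, hab⟩ := closure_minimal hsub hcl h1
  exact Subtype.ext hab ▸ hb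

theorem continuous_endo (ρ : QLA →⋆ₐ[ℂ] QLA) : Continuous ρ :=
  AddMonoidHomClass.continuous_of_bound ρ 1 fun a => by
    simpa only [one_mul] using NonUnitalStarAlgHom.norm_apply_le ρ a

theorem Rep.continuous_hom (π : Rep.{u}) : Continuous π.hom :=
  AddMonoidHomClass.continuous_of_bound π.hom 1 fun a => by
    simpa only [one_mul] using NonUnitalStarAlgHom.norm_apply_le π.hom a

theorem endo_ext {ρ ρ' : QLA →⋆ₐ[ℂ] QLA} (hX : ∀ s, ρ (opX s) = ρ' (opX s))
    (hZ : ∀ s, ρ (opZ s) = ρ' (opZ s)) : ρ = ρ' := by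
  ext1 a
  let P : Submodule ℂ QLA := LinearMap.eqLocus ρ.toAlgHom.toLinearMap ρ'.toAlgHom.toLinearMap
  refine mem_of_opX_mul_opZ_mem P (isClosed_eq (continuous_endo ρ) (continuous_endo ρ'))
    (fun s t => ?_) a
  change ρ _ = ρ' _
  rw [map_mul, map_mul, hX, hZ]

/-! ### Pauli endomorphisms -/

/-- The sign `(-1)^a`. -/
def sgn (a : ZMod 2) : ℂ := (-1) ^ a.val

theorem sgn_natCast (n : ℕ) : sgn n = (-1) ^ n := by
  rw [sgn, ZMod.val_natCast, ← neg_one_pow_eq_pow_mod_two]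

theorem sgn_zero : sgn 0 = 1 := by simp [sgn]

theorem sgn_add (a b : ZMod 2) : sgn (a + b) = sgn a * sgn b := by
  have h : ∀ a : ZMod 2, ((a.val : ℕ) : ZMod 2) = a := ZMod.natCast_zmod_val
  rw [← h a, ← h b, ← Nat.cast_add, sgn_natCast, sgn_natCast, sgn_natCast, pow_add]

/-- The indicator function modulo 2 of a set. -/
def ind {α : Type*} (s : Set α) : α → ZMod 2 := s.indicator 1

open Classical in
theorem ind_apply {α : Type*} (s : Set α) (x : α) : ind s x = if x ∈ s then 1 else 0 :=
  Set.indicator_apply _ _ _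

theorem sum_ind (s r : Finset Vertex) : ∑ v ∈ r, ind (s : Set Vertex) v = ((s ∩ r).card : ZMod 2) := by
  classical
  simp [ind_apply, Finset.inter_comm]

/-- `ρ` acts as the conjugation by `⊗_{S v = 1} σ_v^x ⊗_{T v = 1} σ_v^z`. -/
structure IsPauliEndo (ρ : QLA →⋆ₐ[ℂ] QLA) (S T : Vertex → ZMod 2) : Prop where
  -- σ^x anticommutes only with σ^z, so signs on `opX` come from `T` and signs on `opZ` from `S`.
  map_opX : ∀ r, ρ (opX r) = sgn (∑ v ∈ r, T v) • opX r
  map_opZ : ∀ r, ρ (opZ r) = sgn (∑ v ∈ r, S v) • opZ r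

namespace IsPauliEndo

variable {ρ ρ' : QLA →⋆ₐ[ℂ] QLA} {S T S' T' : Vertex → ZMod 2}

theorem unique (h : IsPauliEndo ρ S T) (h' : IsPauliEndo ρ' S T) : ρ = ρ' :=
  endo_ext (fun s => by rw [h.map_opX, h'.map_opX]) (fun s => by rw [h.map_opZ, h'.map_opZ])

/-- Signs multiply, so chains add modulo 2. This turns the tensor product of endomorphisms into a
sum. -/
theorem comp (h : IsPauliEndo ρ S T) (h' : IsPauliEndo ρ' S' T') :
    IsPauliEndo (ρ.comp ρ') (S + S') (T + T') where
  map_opX r := by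
    change ρ (ρ' _) = _
    rw [h'.map_opX, map_smul, h.map_opX, smul_smul, ← sgn_add, add_comm]
    simp only [Pi.add_apply, Finset.sum_add_distrib]
  map_opZ r := by
    change ρ (ρ' _) = _
    rw [h'.map_opZ, map_smul, h.map_opZ, smul_smul, ← sgn_add, add_comm]
    simp only [Pi.add_apply, Finset.sum_add_distrib]

theorem id : IsPauliEndo (StarAlgHom.id ℂ QLA) 0 0 where
  map_opX r := by simp [sgn_zero]
  map_opZ r := by simp [sgn_zero]

/-- The chains of the square are `S + S = 0` and `T + T = 0`, so Pauli endomorphisms are involutions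
and in particular surjective. -/
theorem apply_apply (h : IsPauliEndo ρ S T) (a : QLA) : ρ (ρ a) = a := by
  have h2 := h.comp h
  rw [CharTwo.add_self_eq_zero, CharTwo.add_self_eq_zero] at h2
  exact DFunLike.congr_fun (h2.unique IsPauliEndo.id) a

/-- A Pauli endomorphism that does nothing on the vertices of `M` fixes `𝒜(M)`. -/
theorem apply_eq_self (h : IsPauliEndo ρ S T) {M : Set Vertex} (hS : ∀ v ∈ M, S v = 0)
    (hT : ∀ v ∈ M, T v = 0) {a : QLA} (ha : (a : Conf →L[ℂ] Conf) ∈ localAlgebra M) :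
    ρ a = a := by
  -- The fixed points form a closed ⋆-subalgebra of operators, so only the generators at the
  -- vertices of `M` need checking.
  let E : StarSubalgebra ℂ (Conf →L[ℂ] Conf) :=
    (StarAlgHom.equalizer ρ (StarAlgHom.id ℂ QLA)).map (localAlgebra Set.univ).subtype
  have hE : IsClosed (E : Set (Conf →L[ℂ] Conf)) :=
    (isClosed_localAlgebra Set.univ).isClosedEmbedding_subtypeVal.isClosedMap _
      (isClosed_eq (continuous_endo ρ) continuous_id)
  have hle : localAlgebra M ≤ E := by
    refine StarSubalgebra.topologicalClosure_minimal (StarAlgebra.adjoin_le ?_) hE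
    rintro _ ⟨v, hv, rfl | rfl⟩
    · refine ⟨opX {v}, ?_, rfl⟩
      change ρ _ = _
      rw [h.map_opX, Finset.sum_singleton, hT v hv, sgn_zero, one_smul]
      rfl
    · refine ⟨opZ {v}, ?_, rfl⟩
      change ρ _ = _
      rw [h.map_opZ, Finset.sum_singleton, hS v hv, sgn_zero, one_smul]
      rfl
  obtain ⟨b, hb, hab⟩ := hle ha
  exact Subtype.ext hab ▸ hb

end IsPauliEndo

/-- Conjugation by the finite Pauli operators `X_{s n} Z_{t n}` converges, if `s n` and `t n`
converge to sets. -/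
theorem isPauliEndo_of_tendsto {ρ : QLA →⋆ₐ[ℂ] QLA} {s t : ℕ → Finset Vertex}
    {S T : Vertex → ZMod 2} (hs : ∀ v, ∀ᶠ n in atTop, ind (s n : Set Vertex) v = S v)
    (ht : ∀ v, ∀ᶠ n in atTop, ind (t n : Set Vertex) v = T v)
    (h : ∀ a, Tendsto (fun n => star (opX (s n) * opZ (t n)) * a * (opX (s n) * opZ (t n)))
      atTop (𝓝 (ρ a))) : IsPauliEndo ρ S T where
  map_opX r := by
    refine tendsto_nhds_unique (h _) (tendsto_const_nhds.congr' ?_)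
    -- Only the finitely many vertices of `r` enter the sign, so the conjugates are eventually
    -- constant.
    filter_upwards [(Filter.eventually_all_finset r).2 fun v _ => ht v] with n hn
    rw [conj_opX, ← sgn_natCast, ← sum_ind, Finset.sum_congr rfl hn]
  map_opZ r := by
    refine tendsto_nhds_unique (h _) (tendsto_const_nhds.congr' ?_)
    filter_upwards [(Filter.eventually_all_finset r).2 fun v _ => hs v] with n hn
    rw [conj_opZ, ← sgn_natCast, Finset.inter_comm, ← sum_ind, Finset.sum_congr rfl hn]

/-! ### Existence of Pauli endomorphisms with arbitrary chains -/

/-- Conjugation by a sequence of unitaries defines an endomorphism, if it converges. -/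
def limitEndo (u : ℕ → unitary QLA)
    (h : ∀ a : QLA, ∃ b, Tendsto (fun n => star (u n : QLA) * a * (u n : QLA)) atTop (𝓝 b)) :
    QLA →⋆ₐ[ℂ] QLA where
  toFun a := (h a).choose
  map_one' := tendsto_nhds_unique (h 1).choose_spec (tendsto_const_nhds.congr fun n => by
    rw [mul_one, Unitary.coe_star_mul_self])
  map_zero' := tendsto_nhds_unique (h 0).choose_spec (tendsto_const_nhds.congr fun n => by
    rw [mul_zero, zero_mul])
  map_mul' a b := tendsto_nhds_unique (h (a * b)).choose_spec
    (((h a).choose_spec.mul (h b).choose_spec).congr fun n => by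
      calc _ = star (u n : QLA) * a * ((u n : QLA) * star (u n : QLA)) * b * (u n : QLA) := by
            simp only [mul_assoc]
        _ = _ := by
          rw [Unitary.mul_star_self_of_mem (u n).2, mul_one]; simp only [mul_assoc])
  map_add' a b := tendsto_nhds_unique (h (a + b)).choose_spec
    (((h a).choose_spec.add (h b).choose_spec).congr fun n => by rw [mul_add, add_mul])
  commutes' r := tendsto_nhds_unique (h _).choose_spec (tendsto_const_nhds.congr fun n => by
    rw [← Algebra.commutes, mul_assoc, Unitary.coe_star_mul_self, mul_one])
  map_star' a := tendsto_nhds_unique (h (star a)).choose_spec ((h a).choose_spec.star.congr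
    fun n => by simp only [star_mul, star_star, mul_assoc])

theorem tendsto_limitEndo (u : ℕ → unitary QLA)
    (h : ∀ a : QLA, ∃ b, Tendsto (fun n => star (u n : QLA) * a * (u n : QLA)) atTop (𝓝 b))
    (a : QLA) : Tendsto (fun n => star (u n : QLA) * a * (u n : QLA)) atTop
      (𝓝 (limitEndo u h a)) := (h a).choose_spec

/-- On each generator the conjugates are eventually constant, and the operators with convergent
conjugates form a closed ⋆-subalgebra. -/
theorem exists_tendsto_conj {s t : ℕ → Finset Vertex} {S T : Vertex → ZMod 2}
    (hs : ∀ v, ∀ᶠ n in atTop, ind (s n : Set Vertex) v = S v)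
    (ht : ∀ v, ∀ᶠ n in atTop, ind (t n : Set Vertex) v = T v) (a : QLA) :
    ∃ b, Tendsto (fun n => star (opX (s n) * opZ (t n)) * a * (opX (s n) * opZ (t n)))
      atTop (𝓝 b) := by
  have hmem : ∀ n, opX (s n) * opZ (t n) ∈ unitary QLA := fun n =>
    mul_mem (opX_mem_unitary _) (opZ_mem_unitary _)
  let u : ℕ → unitary (Conf →L[ℂ] Conf) := fun n => ⟨(opX (s n) * opZ (t n) : QLA), by
    have h := Unitary.mem_iff.1 (hmem n)
    exact Unitary.mem_iff.2 ⟨congrArg Subtype.val h.1, congrArg Subtype.val h.2⟩⟩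
  have hle : localAlgebra Set.univ ≤ convergenceAlgebra u := by
    refine StarSubalgebra.topologicalClosure_minimal (StarAlgebra.adjoin_le ?_)
      (isClosed_convergenceAlgebra u)
    rintro _ ⟨v, -, rfl | rfl⟩
    · refine ⟨sgn (T v) • pauliX {v}, tendsto_const_nhds.congr' ?_⟩
      filter_upwards [ht v] with n hn
      have := congrArg Subtype.val (conj_opX (s n) (t n) {v})
      rw [← sgn_natCast, ← sum_ind, Finset.sum_singleton, hn] at this
      exact this.symm
    · refine ⟨sgn (S v) • pauliZ {v}, tendsto_const_nhds.congr' ?_⟩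
      filter_upwards [hs v] with n hn
      have := congrArg Subtype.val (conj_opZ (s n) (t n) {v})
      rw [← sgn_natCast, Finset.inter_comm, ← sum_ind, Finset.sum_singleton, hn] at this
      exact this.symm
  obtain ⟨L, hL⟩ := hle a.2
  refine cauchySeq_tendsto_of_complete ?_
  have h : CauchySeq fun n => ((star (opX (s n) * opZ (t n)) * a * (opX (s n) * opZ (t n)) : QLA) :
    Conf →L[ℂ] Conf) := hL.cauchySeq
  exact (isometry_subtype_coe.isUniformInducing.cauchy_map_iff).1 (by rw [map_map]; exact h)

theorem exists_finset_ind_eventually (S : Vertex → ZMod 2) :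
    ∃ s : ℕ → Finset Vertex, ∀ v, ∀ᶠ n in atTop, ind (s n : Set Vertex) v = S v := by
  classical
  obtain ⟨e⟩ : Nonempty (Vertex ≃ ℕ) := ⟨Denumerable.eqv _⟩
  refine ⟨fun n => ((Finset.range n).image e.symm).filter fun v => S v ≠ 0, fun v => ?_⟩
  filter_upwards [eventually_gt_atTop (e v)] with n hn
  have h : v ∈ (Finset.range n).image e.symm :=
    Finset.mem_image.2 ⟨e v, Finset.mem_range.2 hn, e.symm_apply_apply v⟩
  rw [ind_apply, Finset.coe_filter, Set.mem_ofPred_eq]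
  by_cases h0 : S v = 0
  · simp [h0]
  · have h1 : ∀ a : ZMod 2, a ≠ 0 → a = 1 := by decide
    rw [if_pos ⟨h, h0⟩, h1 _ h0]

theorem exists_isPauliEndo (S T : Vertex → ZMod 2) :
    ∃ ρ : QLA →⋆ₐ[ℂ] QLA, IsPauliEndo ρ S T := by
  obtain ⟨s, hs⟩ := exists_finset_ind_eventually S
  obtain ⟨t, ht⟩ := exists_finset_ind_eventually T
  let u : ℕ → unitary QLA := fun n =>
    ⟨opX (s n) * opZ (t n), mul_mem (opX_mem_unitary _) (opZ_mem_unitary _)⟩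
  exact ⟨limitEndo u (exists_tendsto_conj hs ht),
    isPauliEndo_of_tendsto hs ht (tendsto_limitEndo u (exists_tendsto_conj hs ht))⟩

/-- The Pauli endomorphism with `σ^x` on the support of `S` and `σ^z` on the support of `T`. -/
def pauliEndo (S T : Vertex → ZMod 2) : QLA →⋆ₐ[ℂ] QLA := (exists_isPauliEndo S T).choose

theorem isPauliEndo_pauliEndo (S T : Vertex → ZMod 2) : IsPauliEndo (pauliEndo S T) S T :=
  (exists_isPauliEndo S T).choose_spec

theorem pauliEndo_comp (S T S' T' : Vertex → ZMod 2) :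
    (pauliEndo S T).comp (pauliEndo S' T') = pauliEndo (S + S') (T + T') :=
  ((isPauliEndo_pauliEndo S T).comp (isPauliEndo_pauliEndo S' T')).unique
    (isPauliEndo_pauliEndo _ _)

/-- Finite chains give inner automorphisms, so changing a chain at finitely many vertices does not
change the sector. -/
theorem pauliEndo_ind (s t : Finset Vertex) (a : QLA) :
    pauliEndo (ind s) (ind t) a = star (opX s * opZ t) * a * (opX s * opZ t) := by
  let u : ℕ → unitary QLA := fun n =>
    ⟨opX s * opZ t, mul_mem (opX_mem_unitary _) (opZ_mem_unitary _)⟩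
  have hu : ∀ a : QLA, ∃ b, Tendsto (fun n => star (u n : QLA) * a * (u n : QLA)) atTop (𝓝 b) :=
    fun a => ⟨star (opX s * opZ t) * a * (opX s * opZ t), tendsto_const_nhds⟩
  have h : IsPauliEndo (limitEndo u hu) (ind s) (ind t) :=
    isPauliEndo_of_tendsto (s := fun _ => s) (t := fun _ => t) (fun _ => by simp) (fun _ => by simp)
      (tendsto_limitEndo u hu)
  rw [(isPauliEndo_pauliEndo _ _).unique h]
  exact tendsto_nhds_unique (tendsto_limitEndo u hu a) tendsto_const_nhds

/-- The `σ^x` part of a Pauli type. -/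
def PauliType.xPart : PauliType → ℕ
  | .x => 1
  | .y => 1
  | .z => 0

/-- The `σ^z` part of a Pauli type. -/
def PauliType.zPart : PauliType → ℕ
  | .x => 0
  | .y => 1
  | .z => 1

/-! ### String endomorphisms as Pauli endomorphisms -/

namespace HalfInfiniteString

variable {c : Color}

theorem ind_support_eventually (γ : HalfInfiniteString c) (v : Vertex) :
    ∀ᶠ n in atTop, ind (γ.support n : Set Vertex) v = ind (Set.range γ.vert) v := by
  obtain ⟨N, hN⟩ := γ.mem_support_eventually v
  by_cases h : v ∈ Set.range γ.vert
  · obtain ⟨m, rfl⟩ := h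
    filter_upwards [eventually_gt_atTop m] with n hn
    have h1 : γ.vert m ∈ γ.support n :=
      Finset.mem_image_of_mem _ (Finset.mem_range.2 (by omega))
    simp [ind_apply, h1]
  · refine Eventually.of_forall fun n => ?_
    have h1 : v ∉ γ.support n := fun hv => by
      obtain ⟨m, -, rfl⟩ := Finset.mem_image.1 hv
      exact h ⟨m, rfl⟩
    rw [ind_apply, ind_apply, if_neg h, if_neg (by simpa using h1)]

theorem isPauliEndo_endo (γ : HalfInfiniteString c) (k : PauliType) :
    IsPauliEndo (γ.endo k) (k.xPart • ind (Set.range γ.vert)) (k.zPart • ind (Set.range γ.vert)) := by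
  -- For types x and z, the missing factor is the constant sequence of empty products.
  have h0 : ∀ v, ∀ᶠ n : ℕ in atTop, ind (((fun _ => ∅) n : Finset Vertex) : Set Vertex) v =
      (0 : Vertex → ZMod 2) v := fun v => by simp [ind_apply]
  cases k
  · change IsPauliEndo _ ((1 : ℕ) • _) ((0 : ℕ) • _)
    rw [one_smul, zero_smul]
    refine isPauliEndo_of_tendsto γ.ind_support_eventually h0 fun a => ?_
    simpa only [opZ_empty, mul_one] using! γ.tendsto_endoFun .x a
  · change IsPauliEndo _ ((1 : ℕ) • _) ((1 : ℕ) • _)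
    rw [one_smul]
    exact isPauliEndo_of_tendsto γ.ind_support_eventually γ.ind_support_eventually
      (γ.tendsto_endoFun .y)
  · change IsPauliEndo _ ((0 : ℕ) • _) ((1 : ℕ) • _)
    rw [one_smul, zero_smul]
    refine isPauliEndo_of_tendsto h0 γ.ind_support_eventually fun a => ?_
    simpa only [opX_empty, one_mul] using! γ.tendsto_endoFun .z a

theorem endo_eq (γ : HalfInfiniteString c) (k : PauliType) : γ.endo k =
    pauliEndo (k.xPart • ind (Set.range γ.vert)) (k.zPart • ind (Set.range γ.vert)) :=
  (γ.isPauliEndo_endo k).unique (isPauliEndo_pauliEndo _ _)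

end HalfInfiniteString

/-! ### Syndromes -/

instance : Inhabited Face := ⟨baseFace .g⟩

/-- The face with lower left corner `(i, j)`. -/
def mkFace (i j : ℤ) (h : Even (i + j)) : Face := ⟨(i, j), h⟩

/-- The syndrome of a Pauli operator: `bd χ f` is the parity of `χ` on the boundary of `f`. -/
def bd : (Vertex → ZMod 2) →+ (Face → ZMod 2) where
  toFun χ f := ∑ v ∈ f.boundary, χ v
  map_zero' := by ext f; simp
  map_add' χ χ' := by ext f; simp [Finset.sum_add_distrib]

theorem bd_apply (χ : Vertex → ZMod 2) (f : Face) : bd χ f = ∑ v ∈ f.boundary, χ v := rfl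

theorem bd_mk (χ : Vertex → ZMod 2) (i j : ℤ) (h : Even (i + j)) :
    bd χ (mkFace i j h) = χ (i, j) + χ (i + 1, j) + χ (i + 2, j) +
      (χ (i, j + 1) + χ (i + 1, j + 1) + χ (i + 2, j + 1)) := by
  have h3 : Finset.Icc i (i + 2) = {i, i + 1, i + 2} := by
    ext x; simp only [Finset.mem_Icc, Finset.mem_insert, Finset.mem_singleton]; omega
  have h2 : Finset.Icc j (j + 1) = {j, j + 1} := by
    ext x; simp only [Finset.mem_Icc, Finset.mem_insert, Finset.mem_singleton]; omega
  rw [bd_apply, Face.boundary, mkFace, Finset.sum_product_right]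
  dsimp only
  rw [h3, h2, Finset.sum_pair (by omega)]
  congr 1 <;>
  · rw [Finset.sum_insert (by simp), Finset.sum_pair (by omega), add_assoc]

open Classical in
theorem bd_ind_singleton (v : Vertex) (f : Face) :
    bd (ind {v}) f = if v ∈ f.boundary then 1 else 0 := by
  simp [bd_apply, ind_apply]

theorem bd_ind_boundary (f : Face) : bd (ind f.boundary) = 0 := by
  ext g
  rw [bd_apply, sum_ind]
  exact (ZMod.natCast_eq_zero_iff_even).2 (even_inter f g)

/-- The functions with finite support. -/
def finSupp : AddSubgroup (Vertex → ZMod 2) where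
  carrier := {χ | χ.support.Finite}
  zero_mem' := by simp
  add_mem' {a b} ha hb := (Set.Finite.union ha hb).subset (Function.support_add a b)
  neg_mem' {a} ha := by simpa using! ha

theorem ind_mem_finSupp (s : Finset Vertex) : ind s ∈ finSupp :=
  s.finite_toSet.subset Set.support_indicator_subset

theorem exists_eq_ind_of_mem_finSupp {χ : Vertex → ZMod 2} (h : χ ∈ finSupp) :
    ∃ s : Finset Vertex, χ = ind s := by
  classical
  have hfin : χ.support.Finite := h
  refine ⟨hfin.toFinset, funext fun v => ?_⟩
  rw [ind_apply, Set.Finite.coe_toFinset]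
  by_cases h0 : χ v = 0
  · simp [h0]
  · have h1 : ∀ a : ZMod 2, a ≠ 0 → a = 1 := by decide
    rw [if_pos (Function.mem_support.2 h0), h1 _ h0]

/-! ### Finite closed chains are sums of faces -/

/-- The group generated by the boundaries of the faces. -/
def faceGroup : AddSubgroup (Vertex → ZMod 2) :=
  AddSubgroup.closure (Set.range fun f : Face => ind f.boundary)

/-- Any three consecutive values in the row sum to zero, so starting beyond the right end of the
finite support all values vanish one after another towards the left. -/
theorem mem_faceGroup_of_single_row {χ : Vertex → ZMod 2} (hχ : χ ∈ finSupp) (hbd : bd χ = 0) {j : ℤ}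
    (hrow : ∀ v : Vertex, v.2 ≠ j → χ v = 0) : χ = 0 := by
  -- Three consecutive vertices are the bottom side of a face if `x + j` is even and the top side of
  -- one if it is odd; the other side of that face lies off the row.
  have key : ∀ x : ℤ, χ (x, j) + χ (x + 1, j) + χ (x + 2, j) = 0 := by
    intro x
    rcases Int.even_or_odd (x + j) with h | h
    · have := congrFun hbd (mkFace x j h)
      rwa [bd_mk, hrow (x, j + 1) (by simp), hrow (x + 1, j + 1) (by simp),
        hrow (x + 2, j + 1) (by simp), Pi.zero_apply, add_zero, add_zero, add_zero] at this
    · have h' : Even (x + (j - 1)) := by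
        rw [Int.odd_iff] at h; rw [Int.even_iff]; omega
      have := congrFun hbd (mkFace x (j - 1) h')
      rwa [bd_mk, hrow (x, j - 1) (by simp), hrow (x + 1, j - 1) (by simp),
        hrow (x + 2, j - 1) (by simp), Pi.zero_apply, add_zero, add_zero, zero_add,
        sub_add_cancel] at this
  obtain ⟨M, hM⟩ := (Set.Finite.image Prod.fst hχ).bddAbove
  have h0 : ∀ n : ℕ, ∀ x : ℤ, M - n < x → χ (x, j) = 0 := by
    intro n
    induction n with
    | zero =>
      intro x hx
      by_contra hne
      have := hM ⟨(x, j), hne, rfl⟩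
      dsimp only at this
      push_cast at hx
      omega
    | succ n ih =>
      intro x hx
      push_cast at hx
      have := key x
      rwa [ih (x + 1) (by omega), ih (x + 2) (by omega), add_zero, add_zero] at this
  ext ⟨x, y⟩
  by_cases hy : y = j
  · subst hy
    exact h0 (M - x + 1).toNat x (by omega)
  · exact hrow (x, y) hy

/-- The top row of a closed chain can be removed by adding faces. -/
theorem exists_remove_top_row {j₀ j : ℤ} (hj : j₀ < j) (E : Finset ℤ) :
    ∀ χ ∈ finSupp, bd χ = 0 → (∀ v : Vertex, v.2 < j₀ ∨ j < v.2 → χ v = 0) →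
      (∀ x : ℤ, Even (x + j) → χ (x, j) ≠ 0 → x ∈ E) →
      ∃ χ' ∈ finSupp, bd χ' = 0 ∧ (∀ v : Vertex, v.2 < j₀ ∨ j - 1 < v.2 → χ' v = 0) ∧
        χ + χ' ∈ faceGroup := by
  classical
  induction E using Finset.induction_on with
  | empty =>
    intro χ hχ hbd hrow hE
    refine ⟨χ, hχ, hbd, fun v hv => ?_, by rw [CharTwo.add_self_eq_zero]; exact zero_mem _⟩
    rcases lt_or_ge j v.2 with h | h
    · exact hrow v (Or.inr h)
    rcases hv with hv | hv
    · exact hrow v (Or.inl hv)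
    obtain ⟨x, y⟩ := v
    obtain rfl : y = j := by dsimp only at h hv; omega
    have hev : ∀ x : ℤ, Even (x + y) → χ (x, y) = 0 := fun x hx => by
      by_contra h0
      exact absurd (hE x hx h0) (Finset.notMem_empty x)
    rcases Int.even_or_odd (x + y) with hx | hx
    · exact hev x hx
    -- The face above the row whose bottom side is centred at `x`: its outer bottom vertices sit at
    -- even positions and its top side lies above the support, so only `χ (x, y)` is left.
    · have h1 : Even (x - 1 + y) := by rw [Int.odd_iff] at hx; rw [Int.even_iff]; omega
      have h2 : Even (x - 1 + 2 + y) := by rw [Int.odd_iff] at hx; rw [Int.even_iff]; omega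
      have := congrFun hbd (mkFace (x - 1) y h1)
      rwa [bd_mk, hev _ h1, hev _ h2, hrow (_, y + 1) (by simp), hrow (_, y + 1) (by simp),
        hrow (_, y + 1) (by simp), Pi.zero_apply, add_zero, add_zero, add_zero, add_zero, zero_add,
        sub_add_cancel] at this
  | insert x E hx ih =>
    intro χ hχ hbd hrow hE
    by_cases h0 : Even (x + j) ∧ χ (x, j) ≠ 0
    · have hev : Even (x - 1 + (j - 1)) := by
        have := h0.1; rw [Int.even_iff] at this ⊢; omega
      -- The face below the row whose top side is centred at `x`. Adding it clears `x`; its other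
      -- top vertices are at odd positions, and its bottom row `j - 1` is still at least `j₀`.
      let f : Face := ⟨(x - 1, j - 1), hev⟩
      have hmem : ∀ v : Vertex, v ∈ (f.boundary : Set Vertex) ↔
          (x - 1 ≤ v.1 ∧ v.1 ≤ x + 1) ∧ (j - 1 ≤ v.2 ∧ v.2 ≤ j) := fun v => by
        simp only [Face.boundary, f, Finset.coe_product, Set.mem_prod, Finset.coe_Icc, Set.mem_Icc]
        omega
      obtain ⟨χ', h1, h2, h3, h4⟩ := ih (χ + ind f.boundary)
        (add_mem hχ (ind_mem_finSupp _)) (by rw [map_add, hbd, bd_ind_boundary, add_zero])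
        (fun v hv => by
          rw [Pi.add_apply, hrow v hv, ind_apply, if_neg (by rw [hmem]; omega), add_zero])
        (fun y hy hne => by
          rw [Pi.add_apply, ind_apply] at hne
          by_cases hyx : y = x
          · subst hyx
            have h1 : ∀ a : ZMod 2, a ≠ 0 → a + 1 = 0 := by decide
            rw [if_pos (by rw [hmem]; dsimp only; omega), h1 _ h0.2] at hne
            exact absurd rfl hne
          · rw [if_neg, add_zero] at hne
            · exact (Finset.mem_insert.1 (hE y hy hne)).resolve_left hyx
            · have h2 := h0.1
              rw [Int.even_iff] at h2 hy
              rw [hmem]; dsimp only; omega)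
      refine ⟨χ', h1, h2, h3, ?_⟩
      have h5 : ind (f.boundary : Set Vertex) ∈ faceGroup := AddSubgroup.subset_closure ⟨f, rfl⟩
      have h6 := add_mem h4 h5
      have h7 : χ + ind (f.boundary : Set Vertex) + χ' + ind (f.boundary : Set Vertex) =
          χ + χ' + (ind (f.boundary : Set Vertex) + ind (f.boundary : Set Vertex)) := by abel
      rwa [h7, CharTwo.add_self_eq_zero, add_zero] at h6
    · refine ih χ hχ hbd hrow fun y hy hne => (Finset.mem_insert.1 (hE y hy hne)).resolve_left ?_
      rintro rfl
      exact h0 ⟨hy, hne⟩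

/-- Adding faces removes one row at a time from the top, until a closed chain in a single row is
left, which is zero. -/
theorem mem_faceGroup_of_rows {j₀ : ℤ} (n : ℕ) : ∀ χ ∈ finSupp, bd χ = 0 →
    (∀ v : Vertex, v.2 < j₀ ∨ j₀ + n < v.2 → χ v = 0) → χ ∈ faceGroup := by
  induction n with
  | zero =>
    intro χ hχ hbd hrow
    rw [mem_faceGroup_of_single_row hχ hbd (j := j₀) fun v hv => hrow v (by push_cast; omega)]
    exact zero_mem _
  | succ n ih =>
    intro χ hχ hbd hrow
    obtain ⟨χ', h1, h2, h3, h4⟩ := exists_remove_top_row (j₀ := j₀) (j := j₀ + (n + 1 : ℕ))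
      (by push_cast; omega) (Set.Finite.image Prod.fst hχ).toFinset χ hχ hbd hrow
      (fun x _ hx => by
        rw [Set.Finite.mem_toFinset]
        exact ⟨(x, _), hx, rfl⟩)
    have h5 := sub_mem h4 (ih χ' h1 h2 fun v hv => h3 v (by push_cast; omega))
    rwa [add_sub_cancel_right] at h5

/-- Every finite closed chain is a sum of faces. -/
theorem mem_faceGroup_of_bd_eq_zero {χ : Vertex → ZMod 2} (hχ : χ ∈ finSupp) (hbd : bd χ = 0) :
    χ ∈ faceGroup := by
  have hfin := Set.Finite.image Prod.snd hχ
  obtain ⟨M, hM⟩ := hfin.bddAbove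
  obtain ⟨m, hm⟩ := hfin.bddBelow
  refine mem_faceGroup_of_rows (j₀ := m) (M - m).toNat χ hχ hbd fun v hv => ?_
  by_contra h0
  have h1 := hM ⟨v, h0, rfl⟩
  have h2 := hm ⟨v, h0, rfl⟩
  omega

/-! ### Edges and strings -/

theorem mem_boundary {v : Vertex} {f : Face} : v ∈ f.boundary ↔
    (f.1.1 ≤ v.1 ∧ v.1 ≤ f.1.1 + 2) ∧ (f.1.2 ≤ v.2 ∧ v.2 ≤ f.1.2 + 1) := by
  simp only [Face.boundary, Finset.mem_product, Finset.mem_Icc]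

theorem color_eq_iff {f g : Face} : f.color = g.color ↔ f.1.1 % 3 = g.1.1 % 3 := by
  have hf : f.1.1 % 3 = 0 ∨ f.1.1 % 3 = 1 ∨ f.1.1 % 3 = 2 := by omega
  have hg : g.1.1 % 3 = 0 ∨ g.1.1 % 3 = 1 ∨ g.1.1 % 3 = 2 := by omega
  rcases hf with h | h | h <;> rcases hg with h' | h' | h' <;> simp [Face.color, h, h']

/-- The faces that meet at a vertex have pairwise different colours. -/
theorem face_eq_of_color_eq {f g : Face} {v : Vertex} (hc : f.color = g.color)
    (hf : v ∈ f.boundary) (hg : v ∈ g.boundary) : f = g := by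
  rw [color_eq_iff] at hc
  rw [mem_boundary] at hf hg
  have h1 := Int.even_iff.1 f.2
  have h2 := Int.even_iff.1 g.2
  exact Subtype.ext (Prod.ext (by omega) (by omega))

/-- Of the three faces at `u`, two lie along the edge `uv` and contain both ends, so just one is
left. -/
theorem face_eq_of_adj {f g : Face} {u v : Vertex} (h : lattice.Adj u v)
    (hfu : u ∈ f.boundary) (hfv : v ∉ f.boundary) (hgu : u ∈ g.boundary) (hgv : v ∉ g.boundary) :
    f = g := by
  rw [mem_boundary] at hfu hfv hgu hgv
  have h1 := Int.even_iff.1 f.2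
  have h2 := Int.even_iff.1 g.2
  obtain ⟨u1, u2⟩ := u
  obtain ⟨v1, v2⟩ := v
  rw [lattice, SimpleGraph.fromRel_adj] at h
  simp only [Prod.mk.injEq, Int.even_iff] at h hfu hfv hgu hgv
  exact Subtype.ext (Prod.ext (by omega) (by omega))

/-- An edge that connects two faces of the same colour has these faces as its syndrome. -/
theorem bd_edge {f g : Face} {u v : Vertex} (hc : f.color = g.color) (hne : f ≠ g)
    (h : lattice.Adj u v) (hu : u ∈ f.boundary) (hv : v ∈ g.boundary) :
    bd (ind {u} + ind {v}) = ind {f} + ind {g} := by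
  classical
  have hfv : v ∉ f.boundary := fun h' => hne (face_eq_of_color_eq hc h' hv)
  have hgu : u ∉ g.boundary := fun h' => hne (face_eq_of_color_eq hc hu h')
  ext e
  rw [map_add, Pi.add_apply, Pi.add_apply, bd_ind_singleton, bd_ind_singleton, ind_apply, ind_apply]
  simp only [Set.mem_singleton_iff]
  by_cases h1 : u ∈ e.boundary <;> by_cases h2 : v ∈ e.boundary
  -- A face along the edge contains both ends, which cancel modulo 2.
  · rw [if_pos h1, if_pos h2, if_neg (by rintro rfl; exact hfv h2),
      if_neg (by rintro rfl; exact hgu h1)]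
    decide
  · obtain rfl := face_eq_of_adj h h1 h2 hu hfv
    rw [if_pos h1, if_neg h2, if_pos rfl, if_neg hne]
  · obtain rfl := face_eq_of_adj h.symm h2 h1 hv hgu
    rw [if_neg h1, if_pos h2, if_pos rfl, if_neg hne.symm]
  · rw [if_neg h1, if_neg h2, if_neg (by rintro rfl; exact h1 hu),
      if_neg (by rintro rfl; exact h2 hv)]

/-- Each face sees only finitely many vertices, so the syndrome passes to the pointwise limit, and
the far end `g n` of the chain disappears because it leaves every face. -/
theorem bd_of_eventually_eq {S : ℕ → Vertex → ZMod 2} {S' : Vertex → ZMod 2} {f : Face}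
    {g : ℕ → Face} (hS : ∀ v, ∀ᶠ n in atTop, S n v = S' v)
    (hbd : ∀ n, bd (S n) = ind {f} + ind {g n}) (hg : ∀ e, ∀ᶠ n in atTop, g n ≠ e) :
    bd S' = ind {f} := by
  ext e
  obtain ⟨n, hn, hn'⟩ :=
    (((Filter.eventually_all_finset e.boundary).2 fun v _ => hS v).and (hg e)).exists
  rw [bd_apply, ← Finset.sum_congr rfl hn, ← bd_apply, hbd, Pi.add_apply, ind_apply {g n},
    if_neg (by simpa using hn'.symm), add_zero]

namespace HalfInfiniteString

variable {c : Color} (γ : HalfInfiniteString c)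

/-- The edge syndromes telescope along the string. Distinctness of the vertices lets the indicator
of the support split as a sum over the edges. -/
theorem bd_support (n : ℕ) : bd (ind (γ.support n)) = ind {γ.face 0} + ind {γ.face n} := by
  induction n with
  | zero =>
    rw [CharTwo.add_self_eq_zero]
    ext f
    rw [bd_apply, sum_ind]
    simp [support]
  | succ n ih =>
    have h : ind (γ.support (n + 1) : Set Vertex) =
        ind (γ.support n) + (ind {γ.vert (2 * n)} + ind {γ.vert (2 * n + 1)}) := by
      have hnot : ∀ m, 2 * n ≤ m → γ.vert m ∉ γ.support n := fun m hm h => by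
        obtain ⟨k, hk, hkm⟩ := Finset.mem_image.1 h
        have := γ.vert_injective hkm
        rw [Finset.mem_range] at hk
        omega
      have h1 : ({γ.vert (2 * n)} : Set Vertex) ∩ {γ.vert (2 * n + 1)} = ∅ := by
        rw [Set.singleton_inter_eq_empty]
        exact fun h => by have := γ.vert_injective h; omega
      have h2 : (γ.support n : Set Vertex) ∩ {γ.vert (2 * n), γ.vert (2 * n + 1)} = ∅ := by
        ext v
        simp only [Set.mem_inter_iff, Set.mem_insert_iff, Set.mem_singleton_iff,
          Set.mem_empty_iff_false, iff_false, not_and, Finset.mem_coe]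
        rintro hv (rfl | rfl)
        · exact hnot _ le_rfl hv
        · exact hnot _ (Nat.le_succ _) hv
      have h3 : (γ.support (n + 1) : Set Vertex) =
          (γ.support n : Set Vertex) ∪ ({γ.vert (2 * n)} ∪ {γ.vert (2 * n + 1)}) := by
        simp only [support, Nat.mul_succ, Finset.range_add_one, Finset.image_insert,
          Finset.coe_insert]
        ext v
        simp only [Set.mem_insert_iff, Set.mem_union, Set.mem_singleton_iff]
        tauto
      rw [h3, ind, ind, ind, ind, Set.indicator_union_of_disjoint, Set.indicator_union_of_disjoint]
      · rfl
      · exact Set.disjoint_iff_inter_eq_empty.2 h1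
      · exact Set.disjoint_iff_inter_eq_empty.2 h2
    rw [h, map_add, ih, bd_edge ((γ.color_face n).trans (γ.color_face (n + 1)).symm) (γ.face_ne n)
      (γ.adj n) (γ.even_mem n) (γ.odd_mem n), add_assoc, ← add_assoc (ind {γ.face n}),
      CharTwo.add_self_eq_zero, zero_add]

theorem face_ne_eventually (e : Face) : ∀ᶠ n in atTop, γ.face n ≠ e := by
  have hinj : Function.Injective fun n => γ.vert (2 * n) := fun m n h => by
    have := γ.vert_injective h
    omega
  have hfin := (Set.Finite.preimage hinj.injOn e.boundary.finite_toSet)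
  rw [← Nat.cofinite_eq_atTop]
  filter_upwards [hfin.compl_mem_cofinite] with n hn
  rintro rfl
  exact hn (γ.even_mem n)

theorem bd_range : bd (ind (Set.range γ.vert)) = ind {γ.face 0} :=
  bd_of_eventually_eq γ.ind_support_eventually γ.bd_support γ.face_ne_eventually

end HalfInfiniteString

/-! ### Charges -/

/-- The charge of a Pauli operator: its syndrome modulo the syndromes of the finite operators. -/
def charge : (Vertex → ZMod 2) →+ (Face → ZMod 2) ⧸ finSupp.map bd :=
  (QuotientAddGroup.mk' (finSupp.map bd)).comp bd

/-- The charge of a single excited face. -/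
def faceCharge (f : Face) : (Face → ZMod 2) ⧸ finSupp.map bd :=
  QuotientAddGroup.mk' (finSupp.map bd) (ind {f})

theorem charge_eq_zero_of_mem {χ : Vertex → ZMod 2} (h : χ ∈ finSupp) : charge χ = 0 :=
  (QuotientAddGroup.eq_zero_iff _).2 ⟨χ, h, rfl⟩

/-- In characteristic two `S - S'` is `S + S'`, and a finite chain with the same syndrome closes it.
-/
theorem exists_of_charge_eq {S S' : Vertex → ZMod 2} (h : charge S = charge S') :
    ∃ s : Finset Vertex, bd (S + S' + ind s) = 0 := by
  have h1 : charge (S - S') = 0 := by rw [map_sub, h, sub_self]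
  obtain ⟨χ, hχ, hbd⟩ := (QuotientAddGroup.eq_zero_iff _).1 h1
  obtain ⟨s, rfl⟩ := exists_eq_ind_of_mem_finSupp hχ
  refine ⟨s, ?_⟩
  rw [map_add, hbd, CharTwo.sub_eq_add, CharTwo.add_self_eq_zero]

theorem charge_eq_faceCharge {S : Vertex → ZMod 2} {f : Face} (h : bd S = ind {f}) :
    charge S = faceCharge f :=
  congrArg (QuotientAddGroup.mk' (finSupp.map bd)) h

theorem charge_group_add_self (a : (Face → ZMod 2) ⧸ finSupp.map bd) : a + a = 0 := by
  obtain ⟨a, rfl⟩ := QuotientAddGroup.mk_surjective a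
  rw [← QuotientAddGroup.mk_add, CharTwo.add_self_eq_zero, QuotientAddGroup.mk_zero]

/-- The edge is a finite chain that moves the excitation from `f` to `g`. -/
theorem faceCharge_eq_of_adj {f g : Face} {u v : Vertex} (hc : f.color = g.color) (hne : f ≠ g)
    (h : lattice.Adj u v) (hu : u ∈ f.boundary) (hv : v ∈ g.boundary) :
    faceCharge f = faceCharge g := by
  have h1 : faceCharge f + faceCharge g = 0 := by
    rw [faceCharge, faceCharge, ← map_add, ← bd_edge hc hne h hu hv]
    refine charge_eq_zero_of_mem (add_mem ?_ ?_)
    · simpa using ind_mem_finSupp {u}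
    · simpa using ind_mem_finSupp {v}
  rw [eq_neg_of_add_eq_zero_left h1]
  exact neg_eq_of_add_eq_zero_left (charge_group_add_self _)

/-- Faces of the same colour have the same charge. -/
theorem faceCharge_eq_of_color_eq {f g : Face} (hc : f.color = g.color) :
    faceCharge f = faceCharge g := by
  have hev : ∀ m n : ℤ, Even (f.1.1 + 3 * m + (f.1.2 + m + 2 * n)) := fun m n => by
    have := Int.even_iff.1 f.2
    rw [Int.even_iff]; omega
  -- The faces of the colour of `f` are its translates by the lattice spanned by (3, 1) and (0, 2):
  -- the colour fixes the first coordinate modulo 3, and the parity condition on corners then fixes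
  -- the second modulo 2.
  let F : ℤ → ℤ → Face := fun m n => ⟨(f.1.1 + 3 * m, f.1.2 + m + 2 * n), hev m n⟩
  have hcol : ∀ m n m' n', (F m n).color = (F m' n').color := fun m n m' n' => by
    rw [color_eq_iff]; dsimp only [F]; omega
  have hm : ∀ m n, faceCharge (F m n) = faceCharge (F (m + 1) n) := fun m n => by
    -- The horizontal edge from the upper right corner of `F m n` to the lower left corner of `F (m
    -- + 1) n`.
    refine faceCharge_eq_of_adj (hcol _ _ _ _) (fun h => ?_)
      (u := (f.1.1 + 3 * m + 2, f.1.2 + m + 2 * n + 1))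
      (v := (f.1.1 + 3 * m + 3, f.1.2 + m + 2 * n + 1)) ?_ ?_ ?_
    · have h' : f.1.1 + 3 * m = f.1.1 + 3 * (m + 1) := congrArg (fun g : Face => g.1.1) h
      omega
    · rw [lattice, SimpleGraph.fromRel_adj]
      simp only [ne_eq, Prod.mk.injEq, and_true]
      omega
    · rw [mem_boundary]; dsimp only [F]; omega
    · rw [mem_boundary]; dsimp only [F]; omega
  have hn : ∀ m n, faceCharge (F m n) = faceCharge (F m (n + 1)) := fun m n => by
    -- The vertical edge from the middle of the top side of `F m n` to the middle of the bottom side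
    -- of `F m (n + 1)`.
    refine faceCharge_eq_of_adj (hcol _ _ _ _) (fun h => ?_)
      (u := (f.1.1 + 3 * m + 1, f.1.2 + m + 2 * n + 1))
      (v := (f.1.1 + 3 * m + 1, f.1.2 + m + 2 * n + 2)) ?_ ?_ ?_
    · have h' : f.1.2 + m + 2 * n = f.1.2 + m + 2 * (n + 1) :=
        congrArg (fun g : Face => g.1.2) h
      omega
    · have := Int.even_iff.1 f.2
      rw [lattice, SimpleGraph.fromRel_adj]
      simp only [ne_eq, Prod.mk.injEq, Int.even_iff, true_and]
      omega
    · rw [mem_boundary]; dsimp only [F]; omega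
    · rw [mem_boundary]; dsimp only [F]; omega
  have key : ∀ m n, faceCharge (F m n) = faceCharge (F 0 0) := fun m n => by
    -- Period one on ℤ means constant, which covers negative steps as well.
    have h1 : Function.Periodic (fun m => faceCharge (F m n)) 1 := fun m => (hm m n).symm
    have h2 : Function.Periodic (fun n => faceCharge (F 0 n)) 1 := fun n => (hn 0 n).symm
    have h3 := h1.int_mul_eq m
    have h4 := h2.int_mul_eq n
    simp only [Int.cast_id, mul_one] at h3 h4
    rw [h3, h4]
  rw [color_eq_iff] at hc
  have h1 := Int.even_iff.1 f.2
  have h2 := Int.even_iff.1 g.2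
  have hf : F 0 0 = f := Subtype.ext (Prod.ext (by dsimp only [F]; omega) (by dsimp only [F]; omega))
  have hg : F ((g.1.1 - f.1.1) / 3) ((g.1.2 - f.1.2 - (g.1.1 - f.1.1) / 3) / 2) = g :=
    Subtype.ext (Prod.ext (by dsimp only [F]; omega) (by dsimp only [F]; omega))
  rw [← hf, ← key, hg]

/-- The charge of an excited face of colour `c`. -/
def colorCharge (c : Color) : (Face → ZMod 2) ⧸ finSupp.map bd := faceCharge (baseFace c)

theorem faceCharge_eq_colorCharge {f : Face} {c : Color} (h : f.color = c) :
    faceCharge f = colorCharge c :=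
  faceCharge_eq_of_color_eq (h.trans (baseFace_color c).symm)

theorem HalfInfiniteString.charge_range {c : Color} (γ : HalfInfiniteString c) :
    charge (ind (Set.range γ.vert)) = colorCharge c :=
  (charge_eq_faceCharge γ.bd_range).trans (faceCharge_eq_colorCharge (γ.color_face 0))

/-- A Pauli operator at a single vertex excites one face of each colour. -/
theorem sum_colorCharge : colorCharge .r + colorCharge .g + colorCharge .b = 0 := by
  -- The vertex (2, 0) is the common vertex of the three base faces.
  have h : bd (ind {((2, 0) : Vertex)}) =
      ind {baseFace .r} + ind {baseFace .g} + ind {baseFace .b} := by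
    classical
    ext f
    rw [bd_ind_singleton]
    simp only [Pi.add_apply, ind_apply, Set.mem_singleton_iff]
    have he : ∀ c, f = baseFace c ↔ f.1.1 = (baseFace c).1.1 ∧ f.1.2 = (baseFace c).1.2 := fun c =>
      ⟨fun h => h ▸ ⟨rfl, rfl⟩, fun h => Subtype.ext (Prod.ext h.1 h.2)⟩
    have hr : f = baseFace .r ↔ f.1.1 = 1 ∧ f.1.2 = -1 := he .r
    have hg : f = baseFace .g ↔ f.1.1 = 0 ∧ f.1.2 = 0 := he .g
    have hb : f = baseFace .b ↔ f.1.1 = 2 ∧ f.1.2 = 0 := he .b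
    have h2 := Int.even_iff.1 f.2
    simp only [mem_boundary, hr, hg, hb]
    split_ifs <;> first | omega | simp
  rw [colorCharge, colorCharge, colorCharge, faceCharge, faceCharge, faceCharge, ← map_add,
    ← map_add, ← h]
  exact charge_eq_zero_of_mem (by simpa using ind_mem_finSupp {((2, 0) : Vertex)})

/-! ### Equivalence of representations -/

namespace Rep

theorem Equiv.symm {π : Rep.{u}} {π' : Rep.{v}} (h : π.Equiv π') : π'.Equiv π := by
  obtain ⟨U, hU⟩ := h
  exact ⟨U.symm, fun a x => by
    rw [LinearIsometryEquiv.symm_apply_eq, hU, LinearIsometryEquiv.apply_symm_apply]⟩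

theorem Equiv.trans {π : Rep.{u}} {π' : Rep.{v}} {π'' : Rep.{w}} (h : π.Equiv π')
    (h' : π'.Equiv π'') : π.Equiv π'' := by
  obtain ⟨U, hU⟩ := h
  obtain ⟨V, hV⟩ := h'
  exact ⟨U.trans V, fun a x => by simp only [LinearIsometryEquiv.trans_apply, hU, hV]⟩

theorem Equiv.comp {π : Rep.{u}} {π' : Rep.{v}} (h : π.Equiv π') (ρ : QLA →⋆ₐ[ℂ] QLA) :
    (π.comp ρ).Equiv (π'.comp ρ) := by
  obtain ⟨U, hU⟩ := h
  exact ⟨U, fun a x => hU (ρ a) x⟩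

theorem comp_comp (π : Rep.{u}) (ρ ρ' : QLA →⋆ₐ[ℂ] QLA) :
    (π.comp ρ).comp ρ' = π.comp (ρ.comp ρ') := rfl

theorem hom_star_inner (π : Rep.{u}) (a : QLA) (x y : π.space) :
    inner ℂ x (π.hom (star a) y) = inner ℂ (π.hom a x) y := by
  rw [map_star, ContinuousLinearMap.star_eq_adjoint, ContinuousLinearMap.adjoint_inner_right]

theorem hom_mul_apply (π : Rep.{u}) (a b : QLA) (x : π.space) :
    π.hom (a * b) x = π.hom a (π.hom b x) := by
  rw [map_mul]; rfl

/-- GNS representations are unique up to unitary equivalence. -/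
theorem IsGNS.equiv {π : Rep.{u}} {π' : Rep.{v}} {ω : QLA →ₗ[ℂ] ℂ} (h : π.IsGNS ω)
    (h' : π'.IsGNS ω) : π.Equiv π' := by
  obtain ⟨Ω, hω, hd⟩ := h
  obtain ⟨Ω', hω', hd'⟩ := h'
  let e : QLA →ₗ[ℂ] π.space :=
    { toFun := fun a => π.hom a Ω
      map_add' := fun a b => by simp
      map_smul' := fun c a => by simp }
  let e' : QLA →ₗ[ℂ] π'.space :=
    { toFun := fun a => π'.hom a Ω'
      map_add' := fun a b => by simp
      map_smul' := fun c a => by simp }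
  -- Both squared norms equal `ω (star a * a)`, so the map between the cyclic orbits is isometric
  -- and extends by density.
  have hnorm : ∀ a, ‖e' a‖ = ‖e a‖ := fun a => by
    have h1 : inner ℂ (e' a) (e' a) = inner ℂ (e a) (e a) := by
      change inner ℂ (π'.hom a Ω') (π'.hom a Ω') = inner ℂ (π.hom a Ω) (π.hom a Ω)
      rw [← hom_star_inner, ← hom_star_inner, ← hom_mul_apply, ← hom_mul_apply, ← hω, ← hω']
    rw [inner_self_eq_norm_sq_to_K, inner_self_eq_norm_sq_to_K] at h1
    exact (sq_eq_sq₀ (norm_nonneg _) (norm_nonneg _)).1 (by exact_mod_cast h1)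
  let U := (LinearEquiv.refl ℂ QLA).extendOfIsometry e e' hd hd' hnorm
  have hU : ∀ a, U (π.hom a Ω) = π'.hom a Ω' := fun a =>
    (LinearEquiv.refl ℂ QLA).extendOfIsometry_eq e e' hd hd' hnorm a
  refine ⟨U, fun a x => ?_⟩
  refine congrFun (DenseRange.equalizer (f := fun b => π.hom b Ω) hd
    (g := fun x => U (π.hom a x)) (h := fun x => π'.hom a (U x)) (by fun_prop) (by fun_prop)
    (funext fun b => ?_)) x
  change U (π.hom a (π.hom b Ω)) = π'.hom a (U (π.hom b Ω))
  rw [← hom_mul_apply, hU, hU, ← hom_mul_apply]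

/-- Surjectivity of `ρ` leaves the orbit of the cyclic vector unchanged, so the same vector is
cyclic for `π ∘ ρ`. -/
theorem IsGNS.comp {π : Rep.{u}} {ω : QLA →ₗ[ℂ] ℂ} (h : π.IsGNS ω) {ρ : QLA →⋆ₐ[ℂ] QLA}
    (hρ : Function.Surjective ρ) : (π.comp ρ).IsGNS (pullback ω ρ) := by
  obtain ⟨Ω, hω, hd⟩ := h
  refine ⟨Ω, fun a => hω (ρ a), ?_⟩
  have h1 : (Set.range fun a => (π.comp ρ).hom a Ω) = Set.range fun a => π.hom a Ω :=
    hρ.range_comp fun a => π.hom a Ω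
  rw [h1]
  exact hd

/-- Inner automorphisms do not change the equivalence class. -/
theorem comp_equiv_of_conj (π : Rep.{u}) {ρ : QLA →⋆ₐ[ℂ] QLA} {u : QLA} (hu : u ∈ unitary QLA)
    (hρ : ∀ a, ρ a = star u * a * u) : (π.comp ρ).Equiv π := by
  have h : ∀ (a : QLA) (x : π.space), π.hom u (π.hom (ρ a) x) = π.hom a (π.hom u x) := fun a x => by
    rw [hρ, ← hom_mul_apply, ← hom_mul_apply, ← mul_assoc, ← mul_assoc,
      Unitary.mul_star_self_of_mem hu, one_mul]
  exact ⟨Unitary.linearIsometryEquiv ⟨π.hom u, Unitary.map_mem π.hom hu⟩, h⟩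

/-! ### Stabilised vectors -/

/-- A unit vector that is fixed by all stabilizers. -/
structure IsVacuum (π : Rep.{u}) (Ω : π.space) : Prop where
  norm_eq_one : ‖Ω‖ = 1
  hom_stabK : ∀ f, π.hom (stabK f) Ω = Ω
  hom_stabJ : ∀ f, π.hom (stabJ f) Ω = Ω

/-- Equality case of the Cauchy–Schwarz inequality for two unit vectors. -/
theorem apply_eq_self_of_inner_eq_one (π : Rep.{u}) {Ω : π.space} (hΩ : ‖Ω‖ = 1) {a : QLA}
    (ha : a ∈ unitary QLA) (h : inner ℂ Ω (π.hom a Ω) = 1) : π.hom a Ω = Ω := by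
  refine ((inner_eq_one_iff_of_norm_eq_one (𝕜 := ℂ) hΩ ?_).1 h).symm
  rw [← hΩ]
  exact (Unitary.linearIsometryEquiv ⟨π.hom a, Unitary.map_mem π.hom ha⟩).norm_map Ω

theorem isVacuum_of_groundState {π : Rep.{u}} {Ω : π.space} {ω : QLA →ₗ[ℂ] ℂ}
    (hω : IsGroundState ω) (h : ∀ a, ω a = inner ℂ Ω (π.hom a Ω)) : IsVacuum π Ω := by
  have h1 : ‖Ω‖ = 1 := by
    have := h 1
    rw [hω.map_one, map_one] at this
    change (1 : ℂ) = inner ℂ Ω Ω at this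
    rw [inner_self_eq_norm_sq_to_K] at this
    have h2 : ((‖Ω‖ ^ 2 : ℝ) : ℂ) = 1 := by rw [this]; simp
    exact (pow_eq_one_iff_of_nonneg (norm_nonneg Ω) two_ne_zero).1 (by exact_mod_cast h2)
  exact ⟨h1,
    fun f => π.apply_eq_self_of_inner_eq_one h1 (opX_mem_unitary _) ((h _).symm.trans (hω.map_stabK f)),
    fun f => π.apply_eq_self_of_inner_eq_one h1 (opZ_mem_unitary _) ((h _).symm.trans (hω.map_stabJ f))⟩

end Rep

/-! ### Uniqueness of the vacuum state -/

theorem ind_coe_injective {s t : Finset Vertex} (h : ind (s : Set Vertex) = ind t) : s = t := by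
  ext v
  have := congrFun h v
  rw [ind_apply, ind_apply] at this
  by_cases h1 : v ∈ s <;> by_cases h2 : v ∈ t <;> simp_all

theorem ind_symmDiff (s t : Finset Vertex) :
    ind ((s ∆ t : Finset Vertex) : Set Vertex) = ind s + ind t := by
  ext v
  rw [Pi.add_apply, ind_apply, ind_apply, ind_apply]
  rw [Finset.mem_coe, Finset.mem_coe, Finset.mem_coe, Finset.mem_symmDiff]
  by_cases h1 : v ∈ s <;> by_cases h2 : v ∈ t <;> simp [h1, h2, CharTwo.add_self_eq_zero]

theorem ind_empty {α : Type*} : ind (∅ : Set α) = 0 := Set.indicator_empty _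

/-- If the face operators fix a vector, so do the operators of all closed chains. -/
theorem fixed_of_bd_eq_zero (π : Rep.{u}) {Ω : π.space} {op : Finset Vertex → QLA}
    (hmul : ∀ s t, op s * op t = op (s ∆ t)) (hone : op ∅ = 1)
    (hfix : ∀ f : Face, π.hom (op f.boundary) Ω = Ω) {s : Finset Vertex} (hs : bd (ind s) = 0) :
    π.hom (op s) Ω = Ω := by
  have key : ∀ χ ∈ faceGroup, ∃ t : Finset Vertex, χ = ind t ∧ π.hom (op t) Ω = Ω := by
    intro χ hχ
    induction hχ using AddSubgroup.closure_induction with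
    | mem χ h =>
      obtain ⟨f, rfl⟩ := h
      exact ⟨f.boundary, rfl, hfix f⟩
    | zero => exact ⟨∅, by rw [Finset.coe_empty, ind_empty], by rw [hone, map_one]; rfl⟩
    | add χ χ' _ _ h h' =>
      obtain ⟨t, rfl, ht⟩ := h
      obtain ⟨t', rfl, ht'⟩ := h'
      exact ⟨t ∆ t', (ind_symmDiff t t').symm, by rw [← hmul, Rep.hom_mul_apply, ht', ht]⟩
    | neg χ _ h => rwa [CharTwo.neg_eq]
  obtain ⟨t, ht, h⟩ := key _ (mem_faceGroup_of_bd_eq_zero (ind_mem_finSupp s) hs)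
  rwa [ind_coe_injective ht]

namespace Rep.IsVacuum

variable {π : Rep.{u}} {Ω : π.space}

theorem inner_eq_one (h : IsVacuum π Ω) {s t : Finset Vertex} (hs : bd (ind s) = 0)
    (ht : bd (ind t) = 0) : inner ℂ Ω (π.hom (opX s * opZ t) Ω) = 1 := by
  rw [hom_mul_apply, fixed_of_bd_eq_zero π opZ_mul opZ_empty h.hom_stabJ ht,
    fixed_of_bd_eq_zero π opX_mul opX_empty h.hom_stabK hs, inner_self_eq_norm_sq_to_K,
    h.norm_eq_one]
  simp

theorem inner_conj {a : QLA} (h : π.hom a Ω = Ω) (b : QLA) :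
    inner ℂ Ω (π.hom (star a * b * a) Ω) = inner ℂ Ω (π.hom b Ω) := by
  rw [mul_assoc, hom_mul_apply, hom_star_inner, h, hom_mul_apply, h]

/-- Some stabilizer fixes `Ω` but anticommutes with the given Pauli operator; conjugating by it
shows that the expectation value equals its own negative. -/
theorem inner_eq_zero (h : IsVacuum π Ω) {s t : Finset Vertex}
    (hst : bd (ind s) ≠ 0 ∨ bd (ind t) ≠ 0) : inner ℂ Ω (π.hom (opX s * opZ t) Ω) = 0 := by
  have key : ∀ p q : Finset Vertex, π.hom (opX p * opZ q) Ω = Ω →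
      sgn (∑ v ∈ q, ind (s : Set Vertex) v + ∑ v ∈ p, ind (t : Set Vertex) v) = -1 →
      inner ℂ Ω (π.hom (opX s * opZ t) Ω) = 0 := fun p q hpq hsgn => by
    have h1 := inner_conj hpq (opX s * opZ t)
    rw [← pauliEndo_ind, map_mul, (isPauliEndo_pauliEndo _ _).map_opX,
      (isPauliEndo_pauliEndo _ _).map_opZ, smul_mul_smul_comm, ← sgn_add, sum_ind, sum_ind,
      Finset.inter_comm, Finset.inter_comm p, ← sum_ind, ← sum_ind, hsgn, map_smul] at h1
    rw [smul_apply, inner_smul_right, neg_one_mul] at h1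
    exact self_eq_neg.1 h1.symm
  have hone : ∀ a : ZMod 2, a ≠ 0 → sgn a = -1 := fun a ha => by
    have h1 : ∀ a : ZMod 2, a ≠ 0 → a = 1 := by decide
    rw [h1 a ha, ← Nat.cast_one, sgn_natCast, pow_one]
  rcases hst with hs | ht
  -- A nonzero syndrome of the σ^x part is detected by some `stabJ f`, and one of the σ^z part by
  -- some `stabK f`.
  · obtain ⟨f, hf⟩ := Function.ne_iff.1 hs
    refine key ∅ f.boundary (by rw [opX_empty, one_mul]; exact h.hom_stabJ f) ?_
    rw [Finset.sum_empty, add_zero]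
    exact hone _ hf
  · obtain ⟨f, hf⟩ := Function.ne_iff.1 ht
    refine key f.boundary ∅ (by rw [opZ_empty, mul_one]; exact h.hom_stabK f) ?_
    rw [Finset.sum_empty, zero_add]
    exact hone _ hf

/-- The vector state of a vacuum vector is unique. -/
theorem inner_eq_inner {π' : Rep.{v}} {Ω' : π'.space} (h : IsVacuum π Ω) (h' : IsVacuum π' Ω')
    (a : QLA) : inner ℂ Ω (π.hom a Ω) = inner ℂ Ω' (π'.hom a Ω') := by
  have hc := π.continuous_hom
  have hc' := π'.continuous_hom
  let φ : QLA →ₗ[ℂ] ℂ :=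
    { toFun := fun a => inner ℂ Ω (π.hom a Ω)
      map_add' := fun a b => by simp
      map_smul' := fun c a => by simp }
  let φ' : QLA →ₗ[ℂ] ℂ :=
    { toFun := fun a => inner ℂ Ω' (π'.hom a Ω')
      map_add' := fun a b => by simp
      map_smul' := fun c a => by simp }
  refine mem_of_opX_mul_opZ_mem (LinearMap.eqLocus φ φ') ?_ (fun s t => ?_) a
  · exact isClosed_eq (f := fun a => inner ℂ Ω (π.hom a Ω))
      (g := fun a => inner ℂ Ω' (π'.hom a Ω')) (by fun_prop) (by fun_prop)
  · change inner ℂ Ω _ = inner ℂ Ω' _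
    by_cases hst : bd (ind s) ≠ 0 ∨ bd (ind t) ≠ 0
    · rw [h.inner_eq_zero hst, h'.inner_eq_zero hst]
    · push Not at hst
      rw [h.inner_eq_one hst.1 hst.2, h'.inner_eq_one hst.1 hst.2]

end Rep.IsVacuum

/-! ### Sectors of given charge -/

theorem pauliEndo_surjective (S T : Vertex → ZMod 2) : Function.Surjective (pauliEndo S T) :=
  fun a => ⟨pauliEndo S T a, (isPauliEndo_pauliEndo S T).apply_apply a⟩

/-- With zero syndromes the endomorphism fixes every stabilizer, so `Ω` is also a vacuum vector of
the composed representation, and uniqueness of the vacuum state shows that the ground state is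
invariant. -/
theorem comp_pauliEndo_equiv_of_bd_eq_zero {π₀ : Rep.{u}} (h₀ : π₀.IsGNS groundState)
    {S T : Vertex → ZMod 2} (hS : bd S = 0) (hT : bd T = 0) :
    (π₀.comp (pauliEndo S T)).Equiv π₀ := by
  refine Rep.IsGNS.equiv (ω := groundState) ?_ h₀
  have hsurj := h₀.comp (pauliEndo_surjective S T)
  obtain ⟨Ω, hω, -⟩ := h₀
  have hvac := Rep.isVacuum_of_groundState groundState_spec hω
  have hP := isPauliEndo_pauliEndo S T
  have hvac' : (π₀.comp (pauliEndo S T)).IsVacuum Ω := by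
    refine ⟨hvac.norm_eq_one, fun f => ?_, fun f => ?_⟩
    · change π₀.hom (pauliEndo S T (opX f.boundary)) Ω = Ω
      rw [hP.map_opX, ← bd_apply, hT, Pi.zero_apply, sgn_zero, one_smul]
      exact hvac.hom_stabK f
    · change π₀.hom (pauliEndo S T (opZ f.boundary)) Ω = Ω
      rw [hP.map_opZ, ← bd_apply, hS, Pi.zero_apply, sgn_zero, one_smul]
      exact hvac.hom_stabJ f
  have hstate : pullback groundState (pauliEndo S T) = groundState := LinearMap.ext fun a =>
    (hω (pauliEndo S T a)).trans ((hvac.inner_eq_inner hvac' a).symm.trans (hω a).symm)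
  rwa [hstate] at hsurj

/-- The sector of a Pauli endomorphism only depends on its charges. -/
theorem comp_pauliEndo_equiv {π₀ : Rep.{u}} (h₀ : π₀.IsGNS groundState)
    {S T S' T' : Vertex → ZMod 2} (hS : charge S = charge S')
    (hT : charge T = charge T') :
    (π₀.comp (pauliEndo S T)).Equiv (π₀.comp (pauliEndo S' T')) := by
  obtain ⟨s, hs⟩ := exists_of_charge_eq hS
  obtain ⟨t, ht⟩ := exists_of_charge_eq hT
  have h1 := (comp_pauliEndo_equiv_of_bd_eq_zero h₀ hs ht).comp (pauliEndo S' T')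
  have h2 := (π₀.comp_equiv_of_conj (mul_mem (opX_mem_unitary s) (opZ_mem_unitary t))
    (pauliEndo_ind s t)).comp (pauliEndo S T)
  have h3 : ∀ a b c : Vertex → ZMod 2, a + b + c + b = c + a := fun a b c => by
    rw [show a + b + c + b = c + a + (b + b) by abel, CharTwo.add_self_eq_zero, add_zero]
  -- The same endomorphism is read in two ways: as a vacuum-preserving one composed with `pauliEndo
  -- S' T'`, and as an inner one composed with `pauliEndo S T`.
  have h4 : (pauliEndo (S + S' + ind s) (T + T' + ind t)).comp (pauliEndo S' T') =
      (pauliEndo (ind s) (ind t)).comp (pauliEndo S T) := by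
    rw [pauliEndo_comp, pauliEndo_comp, h3, h3]
  rw [Rep.comp_comp] at h1 h2
  rw [h4] at h1
  exact h2.symm.trans h1

theorem equiv_comp_pauliEndo {π₀ : Rep.{u}} (h₀ : π₀.IsGNS groundState)
    {π : Rep.{v}} {S T : Vertex → ZMod 2}
    (h : π.IsGNS (pullback groundState (pauliEndo S T))) : π.Equiv (π₀.comp (pauliEndo S T)) :=
  h.equiv (h₀.comp (pauliEndo_surjective S T))

/-! ### Charges in cones -/

/-- Supplies a rational direction near the axis of a cone. -/
theorem denseRange_rat_vector :
    DenseRange fun q : ℚ × ℚ => (!₂[(q.1 : ℝ), (q.2 : ℝ)] : EuclideanSpace ℝ (Fin 2)) := by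
  have h1 : DenseRange fun x : ℝ × ℝ => (!₂[x.1, x.2] : EuclideanSpace ℝ (Fin 2)) :=
    Function.Surjective.denseRange fun x => ⟨(x 0, x 1), by ext i; fin_cases i <;> rfl⟩
  have h2 : DenseRange (Prod.map (Rat.cast : ℚ → ℝ) (Rat.cast : ℚ → ℝ)) :=
    Rat.denseRange_cast.prodMap Rat.denseRange_cast
  refine h1.comp h2 ?_
  refine (PiLp.continuous_toLp 2 _).comp (continuous_pi fun i => ?_)
  fin_cases i
  · exact continuous_fst
  · exact continuous_snd

/-- Some multiple of six points into the cone. -/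
theorem IsCone.exists_translation {Λ : Set Vertex} (hΛ : IsCone Λ) : ∃ m n : ℤ, (m ≠ 0 ∨ n ≠ 0) ∧
    ∀ v : Vertex, ∀ᶠ t : ℕ in atTop, ((v.1 + t * (6 * m), v.2 + t * (6 * n)) : Vertex) ∈ Λ := by
  obtain ⟨p, a, θ, ha, hθ, hθ', rfl⟩ := hΛ
  -- The cone is the set where `φ (x - p)` is positive, and `φ` is continuous and positively
  -- homogeneous.
  let φ : EuclideanSpace ℝ (Fin 2) → ℝ := fun x => inner ℝ x a - ‖x‖ * Real.cos θ
  have hφ : Continuous φ := by fun_prop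
  have hsmul : ∀ (c : ℝ) x, 0 ≤ c → φ (c • x) = c * φ x := fun c x hc => by
    simp only [φ, inner_smul_left, norm_smul, Real.norm_of_nonneg hc, conj_trivial]
    ring
  have hcos : Real.cos θ < 1 := by
    rw [← Real.cos_zero]
    exact Real.cos_lt_cos_of_nonneg_of_le_pi le_rfl hθ'.le hθ
  have hpos : 0 < φ a := by
    simp only [φ, real_inner_self_eq_norm_sq, ha]
    linarith
  obtain ⟨q, hq⟩ := denseRange_rat_vector.exists_mem_open (isOpen_lt continuous_const hφ) ⟨a, hpos⟩
  change 0 < φ _ at hq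
  -- Clearing denominators makes the direction integral. The factor 6 makes the translations respect
  -- the parity of faces and the colours modulo 3.
  set m : ℤ := q.1.num * q.2.den with hm
  set n : ℤ := q.2.num * q.1.den with hn
  have hd1 : (0 : ℝ) < q.1.den := by exact_mod_cast q.1.den_pos
  have hd2 : (0 : ℝ) < q.2.den := by exact_mod_cast q.2.den_pos
  let w : EuclideanSpace ℝ (Fin 2) := !₂[((6 * m : ℤ) : ℝ), ((6 * n : ℤ) : ℝ)]
  have hw : w = (6 * (q.1.den * q.2.den) : ℝ) • !₂[(q.1 : ℝ), (q.2 : ℝ)] := by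
    have e1 : (q.1 : ℝ) * q.1.den = q.1.num := by exact_mod_cast Rat.mul_den_eq_num q.1
    have e2 : (q.2 : ℝ) * q.2.den = q.2.num := by exact_mod_cast Rat.mul_den_eq_num q.2
    ext i
    fin_cases i
    · change ((6 * m : ℤ) : ℝ) = 6 * (q.1.den * q.2.den) * (q.1 : ℝ)
      rw [hm]; push_cast; rw [← e1]; ring
    · change ((6 * n : ℤ) : ℝ) = 6 * (q.1.den * q.2.den) * (q.2 : ℝ)
      rw [hn]; push_cast; rw [← e2]; ring
  have hφw : 0 < φ w := by
    rw [hw, hsmul _ _ (by positivity)]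
    positivity
  refine ⟨m, n, ?_, fun v => ?_⟩
  · by_contra! h
    have hw0 : w = 0 := by
      ext i
      fin_cases i
      · change ((6 * m : ℤ) : ℝ) = 0
        rw [h.1]; simp
      · change ((6 * n : ℤ) : ℝ) = 0
        rw [h.2]; simp
    rw [hw0] at hφw
    simp [φ] at hφw
  -- Rescaled by `1 / t`, the position relative to the apex tends to `w`, where `φ` is positive.
  · have hlim : Tendsto (fun t : ℕ => φ ((t : ℝ)⁻¹ • (Vertex.pos v - p) + w)) atTop (𝓝 (φ w)) := by
      refine (hφ.tendsto w).comp ?_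
      have := (tendsto_inv_atTop_nhds_zero_nat (𝕜 := ℝ)).smul_const (Vertex.pos v - p)
      simpa using this.add_const w
    filter_upwards [hlim.eventually_const_lt hφw, eventually_gt_atTop 0] with t ht ht0
    have ht0' : (0 : ℝ) < t := by exact_mod_cast ht0
    have hpos' : Vertex.pos (v.1 + t * (6 * m), v.2 + t * (6 * n)) - p =
        (t : ℝ) • ((t : ℝ)⁻¹ • (Vertex.pos v - p) + w) := by
      rw [smul_add, smul_inv_smul₀ ht0'.ne']
      have : Vertex.pos (v.1 + t * (6 * m), v.2 + t * (6 * n)) = Vertex.pos v + (t : ℝ) • w := by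
        ext i
        fin_cases i
        · change ((v.1 + t * (6 * m) : ℤ) : ℝ) = v.1 + t * ((6 * m : ℤ) : ℝ)
          push_cast; ring
        · change ((v.2 + t * (6 * n) : ℤ) : ℝ) = v.2 + t * ((6 * n : ℤ) : ℝ)
          push_cast; ring
      rw [this]
      abel
    have h1 : 0 < φ (Vertex.pos (v.1 + t * (6 * m), v.2 + t * (6 * n)) - p) := by
      rw [hpos', hsmul _ _ ht0'.le]
      positivity
    exact sub_pos.1 h1

/-- The sum of the translates of a finite chain of syndrome `{f} + {f + w}` along a ray. -/
theorem exists_ray {Λ : Set Vertex} {m n : ℤ} (hmn : m ≠ 0 ∨ n ≠ 0)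
    (hΛ : ∀ v : Vertex, ∀ᶠ t : ℕ in atTop, ((v.1 + t * (6 * m), v.2 + t * (6 * n)) : Vertex) ∈ Λ)
    (f : Face) : ∃ (S : Vertex → ZMod 2) (g : Face), g.color = f.color ∧ (∀ v ∉ Λ, S v = 0) ∧
      bd S = ind {g} := by
  have hev : ∀ k : ℕ, Even (f.1.1 + k * (6 * m) + (f.1.2 + k * (6 * n))) := fun k => by
    have h1 : f.1.1 + k * (6 * m) + (f.1.2 + k * (6 * n)) =
        f.1.1 + f.1.2 + 2 * (3 * k * m + 3 * k * n) := by ring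
    rw [h1]
    exact f.2.add (even_two_mul _)
  let F : ℕ → Face := fun k => mkFace _ _ (hev k)
  have hF : ∀ k (e : Face), e = F k ↔
      e.1.1 = f.1.1 + k * (6 * m) ∧ e.1.2 = f.1.2 + k * (6 * n) := fun k e =>
    ⟨fun h => h ▸ ⟨rfl, rfl⟩, fun h => Subtype.ext (Prod.ext h.1 h.2)⟩
  have hcol : ∀ k, (F k).color = f.color := fun k => by
    rw [color_eq_iff]
    change (f.1.1 + k * (6 * m)) % 3 = f.1.1 % 3
    have h1 : f.1.1 + k * (6 * m) = f.1.1 + 3 * (2 * k * m) := by ring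
    rw [h1, Int.add_mul_emod_self_left]
  have hinj : ∀ j k : ℕ, (j : ℤ) * (6 * m) = k * (6 * m) → (j : ℤ) * (6 * n) = k * (6 * n) →
      j = k := fun j k h1 h2 => by
    rcases hmn with h | h
    · exact_mod_cast mul_right_cancel₀ (by omega) h1
    · exact_mod_cast mul_right_cancel₀ (by omega) h2
  obtain ⟨P, hP, hbd⟩ : ∃ P ∈ finSupp, bd P = ind {F 0} + ind {F 1} := by
    have h1 : faceCharge (F 0) + faceCharge (F 1) = 0 := by
      rw [faceCharge_eq_of_color_eq ((hcol 0).trans (hcol 1).symm), charge_group_add_self]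
    exact (QuotientAddGroup.eq_zero_iff _).1 h1
  -- `Q k` is `P` translated by `k` steps, and moves the excitation from `F k` to `F (k + 1)`.
  let Q : ℕ → Vertex → ZMod 2 := fun k v => P (v.1 - k * (6 * m), v.2 - k * (6 * n))
  have hQ : ∀ k, bd (Q k) = ind {F k} + ind {F (k + 1)} := fun k => by
    classical
    ext e
    have hev' : Even (e.1.1 - k * (6 * m) + (e.1.2 - k * (6 * n))) := by
      have h1 : e.1.1 - k * (6 * m) + (e.1.2 - k * (6 * n)) =
          e.1.1 + e.1.2 - 2 * (3 * k * m + 3 * k * n) := by ring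
      rw [h1]
      exact e.2.sub (even_two_mul _)
    let e' : Face := mkFace _ _ hev'
    have h1 : bd (Q k) e = bd P e' := by
      rw [bd_apply, bd_apply]
      refine Finset.sum_equiv (Equiv.subRight ((k * (6 * m), k * (6 * n)) : ℤ × ℤ)) (fun v => ?_)
        (fun v _ => rfl)
      rw [mem_boundary, mem_boundary]
      change _ ↔ (e.1.1 - k * (6 * m) ≤ v.1 - k * (6 * m) ∧
        v.1 - k * (6 * m) ≤ e.1.1 - k * (6 * m) + 2) ∧ (e.1.2 - k * (6 * n) ≤ v.2 - k * (6 * n) ∧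
          v.2 - k * (6 * n) ≤ e.1.2 - k * (6 * n) + 1)
      generalize (k : ℤ) * (6 * m) = x
      generalize (k : ℤ) * (6 * n) = y
      omega
    have h2 : ∀ j : ℕ, e' = F j ↔ e = F (k + j) := fun j => by
      rw [hF, hF]
      change e.1.1 - k * (6 * m) = _ ∧ e.1.2 - k * (6 * n) = _ ↔ _
      push_cast
      constructor <;> rintro ⟨h1, h2⟩ <;> constructor <;> linarith
    rw [h1, hbd, Pi.add_apply, Pi.add_apply]
    simp only [ind_apply, Set.mem_singleton_iff, h2, add_zero]
  -- Since `P` has finite support, all translates from some index `T` on lie in the cone.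
  obtain ⟨T, hT⟩ : ∃ T : ℕ, ∀ k ≥ T, ∀ v, P v ≠ 0 →
      ((v.1 + k * (6 * m), v.2 + k * (6 * n)) : Vertex) ∈ Λ := by
    have h1 := (Filter.eventually_all_finite (l := atTop) (p := fun (v : Vertex) (k : ℕ) =>
      ((v.1 + k * (6 * m), v.2 + k * (6 * n)) : Vertex) ∈ Λ) hP).2 fun v _ => hΛ v
    exact eventually_atTop.1 h1
  have hzero : ∀ v, ∃ N : ℕ, ∀ k ≥ N, Q (T + k) v = 0 := fun v => by
    have hinj' : Function.Injective fun k : ℕ =>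
        ((v.1 - (T + k : ℕ) * (6 * m), v.2 - (T + k : ℕ) * (6 * n)) : Vertex) := fun j k h => by
      have h1 := congrArg Prod.fst h
      have h2 := congrArg Prod.snd h
      have := hinj (T + j) (T + k) (by dsimp only at h1; linarith) (by dsimp only at h2; linarith)
      omega
    have hfin := (Set.Finite.preimage hinj'.injOn hP).compl_mem_cofinite
    rw [Nat.cofinite_eq_atTop] at hfin
    obtain ⟨N, hN⟩ := eventually_atTop.1 hfin
    exact ⟨N, fun k hk => by_contra fun h => hN k hk h⟩
  choose N hN using hzero
  let S : ℕ → Vertex → ZMod 2 := fun l => ∑ k ∈ Finset.range l, Q (T + k)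
  have hS : ∀ l, bd (S l) = ind {F T} + ind {F (T + l)} := fun l => by
    induction l with
    | zero => simp [S, CharTwo.add_self_eq_zero]
    | succ l ih =>
      change bd (∑ k ∈ Finset.range (l + 1), Q (T + k)) = _
      rw [Finset.sum_range_succ, map_add]
      change bd (S l) + _ = _
      rw [ih, hQ, add_assoc, ← add_assoc (ind {F (T + l)}), CharTwo.add_self_eq_zero, zero_add]
      rfl
  -- The infinite sum of the translates: at `v` all terms from `N v` on vanish, so this partial sum
  -- is already the limit.
  refine ⟨fun v => S (N v) v, F T, hcol T, fun v hv => ?_, ?_⟩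
  · change (∑ k ∈ Finset.range (N v), Q (T + k)) v = 0
    rw [Finset.sum_apply]
    refine Finset.sum_eq_zero fun k _ => by_contra fun h => hv ?_
    have := hT (T + k) (Nat.le_add_right _ _) _ h
    simpa only [sub_add_cancel] using this
  · refine bd_of_eventually_eq (S := S) (fun v => ?_) hS (fun e => ?_)
    · filter_upwards [eventually_ge_atTop (N v)] with l hl
      change (∑ k ∈ Finset.range l, Q (T + k)) v = (∑ k ∈ Finset.range (N v), Q (T + k)) v
      rw [Finset.sum_apply, Finset.sum_apply]
      refine (Finset.sum_subset (Finset.range_mono hl) fun k _ hk => ?_).symm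
      exact hN v k (by simpa using hk)
    · have hinj' : Function.Injective fun l => F (T + l) := fun j k h => by
        have h1 := (hF (T + k) (F (T + j))).1 h
        have := hinj (T + j) (T + k) (add_left_cancel h1.1) (add_left_cancel h1.2)
        omega
      rw [← Nat.cofinite_eq_atTop]
      filter_upwards [((Set.finite_singleton e).preimage hinj'.injOn).compl_mem_cofinite] with l hl
      exact hl

/-- Every cone supports a Pauli operator with the charge of a given colour. -/
theorem IsCone.exists_charge_eq {Λ : Set Vertex} (hΛ : IsCone Λ) (c : Color) :
    ∃ S : Vertex → ZMod 2, (∀ v ∉ Λ, S v = 0) ∧ charge S = colorCharge c := by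
  obtain ⟨m, n, hmn, h⟩ := hΛ.exists_translation
  obtain ⟨S, g, hg, hS, hbd⟩ := exists_ray hmn h (baseFace c)
  exact ⟨S, hS, (charge_eq_faceCharge hbd).trans
    (faceCharge_eq_colorCharge (hg.trans (baseFace_color c)))⟩

/-! ### Sectors classified by pairs of charges -/

/-- The representation `π` is equivalent to `π₀ ∘ ρ` for a Pauli endomorphism `ρ` whose `σ^x` part
has charge `q` and whose `σ^z` part has charge `p`. -/
def HasCharges (π₀ : Rep.{u}) (π : Rep.{v}) (q p : (Face → ZMod 2) ⧸ finSupp.map bd) : Prop :=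
  ∃ S T, charge S = q ∧ charge T = p ∧ π.Equiv (π₀.comp (pauliEndo S T))

/-- Representatives can be chosen freely within a charge: chains inside a given cone for
localisation, arbitrary strings for fusion. -/
theorem HasCharges.equiv {π₀ : Rep.{u}} (h₀ : π₀.IsGNS groundState) {π : Rep.{v}}
    {S T : Vertex → ZMod 2} (h : HasCharges π₀ π (charge S) (charge T)) :
    π.Equiv (π₀.comp (pauliEndo S T)) := by
  obtain ⟨S', T', hS, hT, hπ⟩ := h
  exact hπ.trans (comp_pauliEndo_equiv h₀ hS hT)

/-- The charge of a pair of strings of colours `c` and `c'`. -/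
def pairCharge (n : ℕ) (c : Color) (n' : ℕ) (c' : Color) : (Face → ZMod 2) ⧸ finSupp.map bd :=
  n • colorCharge c + n' • colorCharge c'

theorem IsCone.exists_pairCharge {Λ : Set Vertex} (hΛ : IsCone Λ) (n : ℕ) (c : Color) (n' : ℕ)
    (c' : Color) : ∃ S : Vertex → ZMod 2, (∀ v ∉ Λ, S v = 0) ∧ charge S = pairCharge n c n' c' := by
  obtain ⟨S, hS, hq⟩ := hΛ.exists_charge_eq c
  obtain ⟨S', hS', hq'⟩ := hΛ.exists_charge_eq c'
  refine ⟨n • S + n' • S', fun v hv => ?_, ?_⟩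
  · simp [hS v hv, hS' v hv]
  · rw [map_add, map_nsmul, map_nsmul, hq, hq', pairCharge]

/-- Representing the charges by chains inside the cone makes the endomorphism the identity on the
algebra of the complement, so the intertwiner serves there as an equivalence with `π₀`. -/
theorem HasCharges.isSuperselectionSector {π₀ : Rep.{u}} (h₀ : π₀.IsGNS groundState) {π : Rep.{v}}
    {n n' m m' : ℕ} {c c' : Color}
    (h : HasCharges π₀ π (pairCharge n c n' c') (pairCharge m c m' c')) :
    Rep.IsSuperselectionSector π₀ π := by
  intro Λ hΛ
  obtain ⟨S, hS, hq⟩ := hΛ.exists_pairCharge n c n' c'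
  obtain ⟨T, hT, hp⟩ := hΛ.exists_pairCharge m c m' c'
  rw [← hq, ← hp] at h
  obtain ⟨U, hU⟩ := h.equiv h₀
  refine ⟨U, fun a ha x => (hU a x).trans ?_⟩
  change π₀.hom (pauliEndo S T a) (U x) = π₀.hom a (U x)
  rw [(isPauliEndo_pauliEndo S T).apply_eq_self hS hT ha]

/-! ### Charges of strings, pairs of strings and fusion products -/

theorem HalfInfiniteString.tensor_endo_eq {c c' : Color} (γ : HalfInfiniteString c) (k : PauliType)
    (γ' : HalfInfiniteString c') (k' : PauliType) : tensor (γ.endo k) (γ'.endo k') =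
      pauliEndo (k.xPart • ind (Set.range γ.vert) + k'.xPart • ind (Set.range γ'.vert))
        (k.zPart • ind (Set.range γ.vert) + k'.zPart • ind (Set.range γ'.vert)) := by
  rw [tensor, endo_eq, endo_eq, pauliEndo_comp]

theorem HalfInfiniteString.charge_pair {c c' : Color} (γ : HalfInfiniteString c)
    (γ' : HalfInfiniteString c') (n n' : ℕ) :
    charge (n • ind (Set.range γ.vert) + n' • ind (Set.range γ'.vert)) = pairCharge n c n' c' := by
  rw [map_add, map_nsmul, map_nsmul, γ.charge_range, γ'.charge_range, pairCharge]

theorem IsBosonSector.hasCharges {π₀ : Rep.{u}} (h₀ : π₀.IsGNS groundState) {π : Rep.{v}}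
    {c : Color} {k : PauliType} (h : IsBosonSector c k π) :
    HasCharges π₀ π (k.xPart • colorCharge c) (k.zPart • colorCharge c) := by
  obtain ⟨γ, -, hγ⟩ := h
  rw [γ.endo_eq] at hγ
  exact ⟨_, _, by rw [map_nsmul, γ.charge_range], by rw [map_nsmul, γ.charge_range],
    equiv_comp_pauliEndo h₀ hγ⟩

theorem IsBosonSector.equiv {π₀ : Rep.{u}} (h₀ : π₀.IsGNS groundState) {π : Rep.{v}}
    {c : Color} {k : PauliType} (h : IsBosonSector c k π) (γ : HalfInfiniteString c) :
    π.Equiv (π₀.comp (γ.endo k)) := by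
  rw [γ.endo_eq]
  refine HasCharges.equiv h₀ ?_
  rw [map_nsmul, map_nsmul, γ.charge_range]
  exact h.hasCharges h₀

theorem hasCharges_of_pairState {π₀ : Rep.{u}} (h₀ : π₀.IsGNS groundState) {π : Rep.{v}}
    {c c' : Color} {k k' : PauliType} (h : π.IsGNS (pairState c k c' k')) :
    HasCharges π₀ π (pairCharge k.xPart c k'.xPart c') (pairCharge k.zPart c k'.zPart c') := by
  change π.IsGNS (pullback groundState (tensor _ _)) at h
  rw [HalfInfiniteString.tensor_endo_eq] at h
  exact ⟨_, _, HalfInfiniteString.charge_pair _ _ _ _, HalfInfiniteString.charge_pair _ _ _ _,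
    equiv_comp_pauliEndo h₀ h⟩

/-- Reduces a fusion relation to two equalities of charges, one for σ^x and one for σ^z. -/
theorem HasCharges.isFusion {π₀ : Rep.{u}} (h₀ : π₀.IsGNS groundState)
    {B : Color → PauliType → Rep.{v}} (hB : ∀ c k, IsBosonSector c k (B c k)) {π : Rep.{w}}
    {q p : (Face → ZMod 2) ⧸ finSupp.map bd} (h : HasCharges π₀ π q p) {c c' : Color}
    {k k' : PauliType} (hq : q = pairCharge k.xPart c k'.xPart c')
    (hp : p = pairCharge k.zPart c k'.zPart c') : IsFusion π₀ B π c k c' k' := by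
  intro γ _ γ' _
  refine ⟨(hB c k).equiv h₀ γ, (hB c' k').equiv h₀ γ', ?_⟩
  rw [HalfInfiniteString.tensor_endo_eq]
  refine HasCharges.equiv h₀ ?_
  rwa [HalfInfiniteString.charge_pair, HalfInfiniteString.charge_pair, ← hq, ← hp]

theorem colorCharge_add {c c' c'' : Color}
    (h : colorCharge c + colorCharge c' + colorCharge c'' = 0) :
    colorCharge c + colorCharge c' = colorCharge c'' := by
  rw [eq_neg_of_add_eq_zero_left h]
  exact neg_eq_of_add_eq_zero_left (charge_group_add_self _)

theorem colorCharge_rg : colorCharge .r + colorCharge .g = colorCharge .b :=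
  colorCharge_add sum_colorCharge

theorem colorCharge_gb : colorCharge .g + colorCharge .b = colorCharge .r :=
  colorCharge_add (by rw [← sum_colorCharge]; abel)

theorem colorCharge_rb : colorCharge .r + colorCharge .b = colorCharge .g :=
  colorCharge_add (by rw [← sum_colorCharge]; abel)

theorem colorCharge_bg : colorCharge .b + colorCharge .g = colorCharge .r := by
  rw [add_comm, colorCharge_gb]

theorem colorCharge_br : colorCharge .b + colorCharge .r = colorCharge .g := by
  rw [add_comm, colorCharge_rb]

end ColorCode

end

open ColorCode
theorem mainTheorem7 (π₀ : Rep.{u}) (h₀ : π₀.IsGNS groundState)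
    (B : Color → PauliType → Rep.{v}) (hB : ∀ c k, IsBosonSector c k (B c k))
    (F : Fermion → Rep.{w}) (hF : ∀ j, (F j).IsGNS (fermionState j)) :
    ((∀ c k, Rep.IsSuperselectionSector π₀ (B c k)) ∧
      ∀ j, Rep.IsSuperselectionSector π₀ (F j)) ∧
    (IsFusion π₀ B (F .f1) .r .x .b .z ∧
      IsFusion π₀ B (F .f1) .r .y .g .z ∧
      IsFusion π₀ B (F .f1) .g .x .b .y) ∧
    (IsFusion π₀ B (F .f2) .r .z .b .x ∧
      IsFusion π₀ B (F .f2) .r .y .g .x ∧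
      IsFusion π₀ B (F .f2) .g .z .b .y) ∧
    (IsFusion π₀ B (F .f3) .b .z .g .y ∧
      IsFusion π₀ B (F .f3) .g .x .r .z ∧
      IsFusion π₀ B (F .f3) .b .x .r .y) ∧
    (IsFusion π₀ B (F .f4) .r .z .g .y ∧
      IsFusion π₀ B (F .f4) .g .x .b .z ∧
      IsFusion π₀ B (F .f4) .r .x .b .y) ∧
    (IsFusion π₀ B (F .f5) .r .x .g .y ∧
      IsFusion π₀ B (F .f5) .b .x .g .z ∧
      IsFusion π₀ B (F .f5) .b .y .r .z) ∧
    (IsFusion π₀ B (F .f6) .b .x .g .y ∧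
      IsFusion π₀ B (F .f6) .r .x .g .z ∧
      IsFusion π₀ B (F .f6) .r .y .b .z) := by
  have h1 := hasCharges_of_pairState h₀ (hF .f1)
  have h2 := hasCharges_of_pairState h₀ (hF .f2)
  have h3 := hasCharges_of_pairState h₀ (hF .f3)
  have h4 := hasCharges_of_pairState h₀ (hF .f4)
  have h5 := hasCharges_of_pairState h₀ (hF .f5)
  have h6 := hasCharges_of_pairState h₀ (hF .f6)
  refine ⟨⟨fun c k => ?_, fun j => ?_⟩, ⟨?_, ?_, ?_⟩, ⟨?_, ?_, ?_⟩, ⟨?_, ?_, ?_⟩, ⟨?_, ?_, ?_⟩,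
    ⟨?_, ?_, ?_⟩, ⟨?_, ?_, ?_⟩⟩
  -- A boson is a pair whose second member has multiplicity 0.
  · refine HasCharges.isSuperselectionSector h₀ (n := k.xPart) (n' := 0) (m := k.zPart) (m' := 0)
      (c := c) (c' := c) ?_
    rw [pairCharge, pairCharge, zero_smul, add_zero, add_zero]
    exact (hB c k).hasCharges h₀
  · cases j
    exacts [h1.isSuperselectionSector h₀, h2.isSuperselectionSector h₀,
      h3.isSuperselectionSector h₀, h4.isSuperselectionSector h₀,
      h5.isSuperselectionSector h₀, h6.isSuperselectionSector h₀]
  all_goals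
    first
    | refine h1.isFusion h₀ hB ?_ ?_
    | refine h2.isFusion h₀ hB ?_ ?_
    | refine h3.isFusion h₀ hB ?_ ?_
    | refine h4.isFusion h₀ hB ?_ ?_
    | refine h5.isFusion h₀ hB ?_ ?_
    | refine h6.isFusion h₀ hB ?_ ?_
  -- What remains are identities such as r = r and b = r + g, settled by the rule that two different
  -- colour charges add up to the third.
  all_goals simp only [pairCharge, PauliType.xPart, PauliType.zPart, one_smul, zero_smul, add_zero,
    zero_add, colorCharge_rg, colorCharge_gb, colorCharge_rb, colorCharge_bg,
    colorCharge_br]
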